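/- A real symmetric matrix $A=(a_{ij})$ is called \emph{fundamental} if $a_{ii}=-2$ for all $i$ and, for all $i\neq j$, $a_{ij}\ge 0$ and $a_{ij}=2\cos(\pi/m_{ij})$ with an integer $m_{ij}\ge 2$ whenever $a_{ij}<2$. It \emph{has minimality} $t$ if all $a_{ij}<t$. Its \emph{ground field} $\mathbb K$ is the subfield of $\mathbb R$ generated over $\mathbb Q$ by all cyclic products $a_{i_1i_2}a_{i_2i_3}\cdots a_{i_{m-1}i_m}a_{i_mi_1}$, and $\widetilde{\mathbb K}=\mathbb Q(\{a_{ij}\})$. A fundamental matrix $A$ is \emph{V-arithmetic} if its form $\sum a_{ij}X_iY_j$ is hyperbolic (of signature $(1,n)$ modulo its kernel), all cyclic products are algebraic integers, $\widetilde{\mathbb K}$ is a totally real number field, and for every embedding $\sigma:\widetilde{\mathbb K}\to\mathbb R$ that is not the identity on $\mathbb K$ the form $\sum\sigma(a_{ij})X_iY_j$ modulo its kernel is negative definite. A hyperbolic fundamental matrix is a \emph{finite edge matrix} with respect to two distinct indices $e_1,e_2$ if it becomes negative definite when the row and column of $e_1$ are removed, and also when those of $e_2$ are removed. It is \emph{connected}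 if its Gram graph (distinct $i,j$ are joined iff $a_{ij}\ne0$) is connected. For integers $3\le s\le k$ and real $u>2$ let $\Gamma_5^{(4)}$ with parameters $s,k,u$ be the graph with Gram matrix $$\begin{pmatrix}-2&2\cos\frac{\pi}{s}&0&0\\ 2\cos\frac{\pi}{s}&-2&u&0\\ 0&u&-2&2\cos\frac{\pi}{k}\\ 0&0&2\cos\frac{\pi}{k}&-2\end{pmatrix},$$ where $e_1,e_2$ are the second and third indices. Let $\mathcal F\Gamma_5^{(4)}(14)$ be the set of ground fields of all V-arithmetic connected finite edge graphs of type $\Gamma_5^{(4)}$ of minimality $14$ (so $2<u<14$), with parameters $3\le s\le k$. \textbf{Theorem.} The ground field $\mathbb K$ of any such graph with parameters $3\le s\le k$ is a number field, and: $[\mathbb K:\mathbb Q]\le 25$ if $s=k=3$; $[\mathbb K:\mathbb Q]\le 21$ if $s=3$, $k=7$; $[\mathbb K:\mathbb Q]\le 21$ if $s=k=7$; $[\mathbb K:\mathbb Q]\le 20$ for all other $3\le s\le k$. In particular, $[\mathbb K:\mathbb Q]\le 25$ for all fields $\mathbb K\in\mathcal F\Gamma_5^{(4)}(14)$. -/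

import Mathlib

open scoped Matrix

noncomputable section

/-- A fundamental matrix: the Gram matrix `(eᵢ · eⱼ)` of (formal) vectors of square `-2` with
`eᵢ · eⱼ ≥ 0` for `i ≠ j`, and `eᵢ · eⱼ = 2 cos (π / m)`, `m ≥ 2` an integer, whenever
`eᵢ · eⱼ < 2`. -/
structure IsFundamental {ι : Type*} (A : Matrix ι ι ℝ) : Prop where
  symm : A.IsSymm
  diag : ∀ i, A i i = -2
  nonneg : ∀ i j, i ≠ j → 0 ≤ A i j
  eq_cos : ∀ i j, i ≠ j → A i j < 2 → ∃ m : ℕ, 2 ≤ m ∧ A i j = 2 * Real.cos (Real.pi / m)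

/-- The form `∑ Aᵢⱼ Xᵢ Yⱼ` modulo its kernel has signature `(1, n)` for some `n`. -/
def HasHyperbolicForm {ι : Type*} [Fintype ι] [DecidableEq ι] (A : Matrix ι ι ℝ) : Prop :=
  sigPos A.toQuadraticForm' = 1

/-- The form `∑ Bᵢⱼ Xᵢ Yⱼ` modulo its kernel is negative definite. -/
def IsNegDefModKernel {ι : Type*} [Fintype ι] (B : Matrix ι ι ℝ) : Prop :=
  ∀ x : ι → ℝ, B *ᵥ x ≠ 0 → x ⬝ᵥ (B *ᵥ x) < 0

/-- The matrix has minimality `t`: all its entries are `< t`. -/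
def HasMinimality {ι : Type*} (t : ℝ) (A : Matrix ι ι ℝ) : Prop :=
  ∀ i j, A i j < t

/-- The cyclic product `a_{i₀ i₁} a_{i₁ i₂} ⋯ a_{i_{m-1} i_m} a_{i_m i₀}`
(addition in `Fin (m + 1)` is cyclic). -/
def cyclicProduct {ι : Type*} (A : Matrix ι ι ℝ) {m : ℕ} (i : Fin (m + 1) → ι) : ℝ :=
  ∏ j, A (i j) (i (j + 1))

/-- The field `ℚ({aᵢⱼ})` generated by the entries. -/
def entryField {ι : Type*} (A : Matrix ι ι ℝ) : IntermediateField ℚ ℝ :=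
  IntermediateField.adjoin ℚ {x | ∃ i j, x = A i j}

/-- The ground field: the field generated over `ℚ` by all the cyclic products. -/
def groundField {ι : Type*} (A : Matrix ι ι ℝ) : IntermediateField ℚ ℝ :=
  IntermediateField.adjoin ℚ {x | ∃ (m : ℕ) (i : Fin (m + 1) → ι), x = cyclicProduct A i}

theorem mem_entryField {ι : Type*} (A : Matrix ι ι ℝ) (i j : ι) : A i j ∈ entryField A :=
  IntermediateField.subset_adjoin ℚ _ ⟨i, j, rfl⟩

/-- The matrix `(σ(aᵢⱼ))`, for an embedding `σ : ℚ({aᵢⱼ}) → ℝ`. -/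
def conjMatrix {ι : Type*} (A : Matrix ι ι ℝ) (σ : entryField A →+* ℝ) : Matrix ι ι ℝ :=
  Matrix.of fun i j => σ ⟨A i j, mem_entryField A i j⟩

/-- V-arithmetic matrices: fundamental matrices with a hyperbolic form that satisfy
Vinberg's arithmeticity conditions (the polyhedron need not have finite volume). -/
structure IsVArithmetic {ι : Type*} [Fintype ι] [DecidableEq ι] (A : Matrix ι ι ℝ) : Prop where
  fundamental : IsFundamental A
  hyperbolic : HasHyperbolicForm A
  integral : ∀ (m : ℕ) (i : Fin (m + 1) → ι), IsIntegral ℤ (cyclicProduct A i)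
  numberField : NumberField (entryField A)
  totallyReal : NumberField.IsTotallyReal (entryField A)
  negDef : ∀ σ : entryField A →+* ℝ,
    (∃ x : entryField A, (x : ℝ) ∈ groundField A ∧ σ x ≠ (x : ℝ)) →
      IsNegDefModKernel (conjMatrix A σ)

/-- Gram matrices of finite edge chambers, with `e₁`, `e₂` the two distinguished elements: the
matrix is hyperbolic, and it becomes negative definite when `e₁` is removed, and when `e₂` is
removed (i.e. both ends of the edge are points of the hyperbolic space). -/
structure IsFiniteEdge {ι : Type*} [Fintype ι] [DecidableEq ι] (A : Matrix ι ι ℝ)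
    (e₁ e₂ : ι) : Prop where
  fundamental : IsFundamental A
  ne : e₁ ≠ e₂
  hyperbolic : HasHyperbolicForm A
  negDef_left : (-(A.submatrix (fun i : {i // i ≠ e₁} => i.1) (fun i => i.1))).PosDef
  negDef_right : (-(A.submatrix (fun i : {i // i ≠ e₂} => i.1) (fun i => i.1))).PosDef

/-- The Gram graph: distinct vertices are joined iff they are not orthogonal. -/
def gramGraph {ι : Type*} (A : Matrix ι ι ℝ) : SimpleGraph ι :=
  SimpleGraph.fromRel fun i j => A i j ≠ 0

/-- The Gram matrix of the graph `Γ₅⁽⁴⁾` with parameters `s`, `k`, `u`, that is, of the path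
`• --s-- e₁ ==u== e₂ --k-- •`; here `e₁` and `e₂` have the indices `1` and `2`. -/
def gamma5Matrix (s k : ℕ) (u : ℝ) : Matrix (Fin 4) (Fin 4) ℝ :=
  !![-2, 2 * Real.cos (Real.pi / s), 0, 0;
     2 * Real.cos (Real.pi / s), -2, u, 0;
     0, u, -2, 2 * Real.cos (Real.pi / k);
     0, 0, 2 * Real.cos (Real.pi / k), -2]

/-- The V-arithmetic connected finite edge graphs (given by their Gram matrices) of type
`Γ₅⁽⁴⁾` with parameters `s`, `k` and of minimality `t`, so that `2 < u < t`. -/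
def gamma5Graphs (t : ℝ) (s k : ℕ) : Set (Matrix (Fin 4) (Fin 4) ℝ) :=
  {A | (∃ u : ℝ, 2 < u ∧ A = gamma5Matrix s k u) ∧ IsVArithmetic A ∧ IsFiniteEdge A 1 2 ∧
    (gramGraph A).Connected ∧ HasMinimality t A}

/-- The set of the ground fields of the V-arithmetic connected finite edge graphs of type
`Γ₅⁽⁴⁾` of minimality `t`. -/
def gamma5Fields (t : ℝ) : Set (IntermediateField ℚ ℝ) :=
  {K | ∃ s k : ℕ, 3 ≤ s ∧ s ≤ k ∧ ∃ A ∈ gamma5Graphs t s k, K = groundField A}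

end

/-! Put `N = [K : ℚ]`, `t = u²`, `a = 4 sin²(π/s)`, `b = 4 sin²(π/k)`. All three are algebraic
integers of the totally real ground field `K`, since squares of entries are cyclic products. At the
given embedding `ι` one has `4 < t < 196`, while at every other embedding arithmeticity forces `0 ≤
4t ≤ ab`. So all conjugates of `t` but one are small, and the norm limits the degree: if `z ≠ 0` is
an integer of `K` and `|τ z| ≤ C |τ w|` for all `τ ≠ ι`, then `1 ≤ |N(z)| ≤ |ι z| C^(N-1) |N(w)| /
|ι w|`. This fails for large `N` once `C` beats the growth of `|N(w)| / |ι w|`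
(`abs_le_mul_pow_mul_abs_norm`, `finrank_le_of_abs_le_mul`).

If both orders lie in `{3, 4, 5, 7}`, then `a` and `b` have degree at most 3 and the intervals `[0,
ab/4]` are explicit. Except for the orders 5 and 7 together, `w = 1`, and `z` is a polynomial in `t`
over `ℤ[b]` whose roots make it small on these intervals, multiplied where useful by units of `ℤ[b]`
that balance the suprema over the conjugates of `b`.

If an order `k` is 6 or at least 8, `w` is a power of `b` (or `ab` if both orders are such) and `z`
is a form in `t` and `b`, or `t` itself. Here `b = -(ζ-1)²/ζ` for a primitive `k`-th root of unity
`ζ`, so `|N(b)|` is `p^(2N/φ(k))` for `k` a power of a prime `p` and 1 otherwise. Since `φ(k)`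
divides `2N`, `1/ι b = O(k²)` is bounded polynomially in `N`, and `|N(b)| ≤ 0.45 · 1.75^N · ι b` for
`N ≥ 21` (`abs_norm_le_mul_apply`). The orders 3, 4, 5, 7 are those with `p^(2/φ(k)) > 1.75`. The
pair 5, 7 uses `w = b²` and the exact norm. Divisibility of `N` by 2 or 3 sharpens the bounds for
the orders 5 and 7. -/

/-! ### Norms in totally real fields -/

section RealEmbeddings

open Module NumberField

theorem exists_real_embedding {K : Type*} [Field K] [NumberField.IsTotallyReal K] (σ : K →+* ℂ) :
    ∃ τ : K →+* ℝ, ∀ x, σ x = (τ x : ℂ) :=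
  ⟨(IsTotallyReal.complexEmbedding_isReal σ).embedding, fun x =>
    ((IsTotallyReal.complexEmbedding_isReal σ).coe_embedding_apply x).symm⟩

variable {K : Type*} [Field K] [NumberField K]

theorem abs_norm_eq_prod (z : K) :
    |((Algebra.norm ℚ z : ℚ) : ℝ)| = ∏ σ : K →ₐ[ℚ] ℂ, ‖σ z‖ := by
  rw [← norm_prod, ← Algebra.norm_eq_prod_embeddings ℚ ℂ z]
  simp

theorem one_le_abs_norm {z : K} (hz : IsIntegral ℤ z) (hz0 : z ≠ 0) :
    1 ≤ |((Algebra.norm ℚ z : ℚ) : ℝ)| := by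
  obtain ⟨n, hn⟩ := IsIntegrallyClosed.isIntegral_iff.1 (Algebra.isIntegral_norm ℚ hz)
  have h0 : Algebra.norm ℚ z ≠ 0 := Algebra.norm_ne_zero_iff.2 hz0
  rw [← hn] at h0 ⊢
  have h1 : n ≠ 0 := by rintro rfl; simp at h0
  have := Int.one_le_abs h1
  simp only [eq_intCast, Rat.cast_intCast]
  exact_mod_cast this

/-- The norm of `z` is a nonzero rational integer, hence at least 1 in absolute value. In its
product over embeddings, every factor other than `ι z` is at most `C |τ w|`, and the product of
these `|τ w|` is `|N(w)| / |ι w|`. -/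
theorem abs_le_mul_pow_mul_abs_norm [IsTotallyReal K] (ι : K →+* ℝ) {z w : K}
    (hz : IsIntegral ℤ z) (hz0 : z ≠ 0) {C : ℝ}
    (h : ∀ τ : K →+* ℝ, τ ≠ ι → |τ z| ≤ C * |τ w|) :
    |ι w| ≤ |ι z| * C ^ (finrank ℚ K - 1) * |((Algebra.norm ℚ w : ℚ) : ℝ)| := by
  classical
  set σ₀ : K →ₐ[ℚ] ℂ := (Complex.ofRealHom.comp ι).toRatAlgHom with hσ₀
  have hσ₀' : ∀ x, ‖σ₀ x‖ = |ι x| := fun x => by simp [hσ₀]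
  have key : ∀ σ ∈ Finset.univ.erase σ₀, ‖σ z‖ ≤ C * ‖σ w‖ := by
    intro σ hσ
    obtain ⟨τ, hτ⟩ := exists_real_embedding (σ : K →+* ℂ)
    have hτ' : ∀ x, σ x = (τ x : ℂ) := hτ
    have : τ ≠ ι := by
      rintro rfl
      refine (Finset.mem_erase.1 hσ).1 (AlgHom.ext fun x => ?_)
      simp [hτ', hσ₀]
    simpa [hτ'] using h τ this
  have h1 := one_le_abs_norm hz hz0
  rw [abs_norm_eq_prod, ← Finset.mul_prod_erase _ _ (Finset.mem_univ σ₀), hσ₀'] at h1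
  have h2 := Finset.prod_le_prod (fun σ _ => norm_nonneg (σ z)) key
  rw [Finset.prod_mul_distrib, Finset.prod_const, Finset.card_erase_of_mem (Finset.mem_univ _),
    Finset.card_univ, AlgHom.card ℚ K ℂ] at h2
  rw [abs_norm_eq_prod, ← Finset.mul_prod_erase _ _ (Finset.mem_univ σ₀), hσ₀']
  calc |ι w| = |ι w| * 1 := (mul_one _).symm
    _ ≤ |ι w| * (|ι z| * (C ^ (finrank ℚ K - 1) * ∏ σ ∈ Finset.univ.erase σ₀, ‖σ w‖)) := by
        gcongr
        exact h1.trans (by gcongr)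
    _ = _ := by ring

end RealEmbeddings

/-! ### The norm of `4 sin²(π/k)` -/

section CyclotomicNorm

open Module Polynomial

/-- With `F = ℚ(ζ)`, the norm of `b ζ = -(ζ-1)²` from `L` is computed through `K` on one side and
through `F` on the other, where `ζ-1` has norm `Φ_k(1)`; roots of unity have norm `±1`. Counting `[L
: ℚ]` both ways relates the exponents. -/
theorem abs_norm_pow_totient_of_cyclotomic {K L : Type*} [Field K] [NumberField K] [Field L]
    [NumberField L] [Algebra K L] {k : ℕ} (hk : 2 < k) {ζ : L} (hζ : IsPrimitiveRoot ζ k) {b : K}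
    (hb : algebraMap K L b * ζ = -(ζ - 1) ^ 2) :
    |Algebra.norm ℚ b| ^ k.totient = |(((cyclotomic k ℤ).eval 1 : ℤ) : ℚ)| ^ (2 * finrank ℚ K) ∧
      finrank K L * finrank ℚ K = finrank (IntermediateField.adjoin ℚ {ζ}) L * k.totient := by
  have : NeZero k := ⟨by lia⟩
  let F := IntermediateField.adjoin ℚ {ζ}
  have hF : IsCyclotomicExtension {k} ℚ F := hζ.intermediateField_adjoin_isCyclotomicExtension ℚ
  have hirr : Irreducible (cyclotomic k ℚ) := cyclotomic.irreducible_rat (by lia)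
  let ζ' : F := IntermediateField.AdjoinSimple.gen ℚ ζ
  have hζ' : algebraMap F L ζ' = ζ := IntermediateField.AdjoinSimple.algebraMap_gen ℚ ζ
  have hζ'p : IsPrimitiveRoot ζ' k := by
    refine IsPrimitiveRoot.of_map_of_injective (f := algebraMap F L) ?_ (algebraMap F L).injective
    rwa [hζ']
  have hrank : finrank K L * finrank ℚ K = finrank F L * k.totient := by
    rw [mul_comm, finrank_mul_finrank, mul_comm, ← IsCyclotomicExtension.finrank F hirr,
      finrank_mul_finrank]
  refine ⟨?_, hrank⟩
  have h1 : Algebra.norm ℚ (ζ - 1) = (((cyclotomic k ℤ).eval 1 : ℤ) : ℚ) ^ finrank F L := by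
    have : ζ - 1 = algebraMap F L (ζ' - 1) := by rw [map_sub, map_one, hζ']
    rw [this, ← Algebra.norm_norm (S := F), Algebra.norm_algebraMap, map_pow,
      hζ'p.sub_one_norm_eq_eval_cyclotomic hk hirr]
  have h2 : |Algebra.norm ℚ ζ| = 1 := by
    have := congrArg (fun x => |Algebra.norm ℚ x|) hζ.pow_eq_one
    simp only [map_pow, map_one, abs_one, abs_pow] at this
    exact (pow_eq_one_iff_of_nonneg (abs_nonneg _) (by lia)).1 this
  have h3 := congrArg (fun x => |Algebra.norm ℚ x|) hb
  have h4 : Algebra.norm ℚ (-(ζ - 1) ^ 2) = Algebra.norm ℚ (-1 : L) * Algebra.norm ℚ (ζ - 1) ^ 2 := by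
    rw [← map_pow, ← map_mul]; congr 1; ring
  have h5 : |Algebra.norm ℚ (-1 : L)| = 1 := by
    have : |Algebra.norm ℚ (-1 : L)| ^ 2 = 1 := by
      rw [← abs_pow, ← map_pow]; simp
    exact (pow_eq_one_iff_of_nonneg (abs_nonneg _) (by lia)).1 this
  have h6 : Algebra.norm ℚ (algebraMap K L b) = Algebra.norm ℚ b ^ finrank K L := by
    rw [← Algebra.norm_norm (S := K), Algebra.norm_algebraMap, map_pow]
  simp only [h4, map_mul, abs_mul, h2, h5, h1, h6, abs_pow, mul_one, one_mul] at h3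
  have hpos : finrank K L ≠ 0 := finrank_pos.ne'
  -- Both sides are raised to the power `[L : K]`, so that the degree relation `hrank` can match the
  -- exponents.
  refine (pow_left_inj₀ (by positivity) (by positivity) hpos).1 ?_
  rw [← pow_mul, mul_comm, pow_mul, h3, ← pow_mul, ← pow_mul, ← pow_mul]
  congr 1
  calc _ = 2 * (finrank F L * k.totient) := by ring
    _ = _ := by rw [← hrank]; ring

/-- Since `ι b = 2 - ζ - ζ⁻¹` with `ζ = exp(2πi/k)`, the root of unity satisfies a monic quadratic
over `K`; `L` is `K(ζ)`. -/
theorem exists_cyclotomic_extension {K : Type*} [Field K] [NumberField K] (ι : K →+* ℝ) {k : ℕ}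
    (hk : 2 < k) {b : K} (hb : ι b = 4 - (2 * Real.cos (Real.pi / k)) ^ 2) :
    ∃ (L : Type) (_ : Field L) (_ : NumberField L) (_ : Algebra K L) (ζ : L),
      IsPrimitiveRoot ζ k ∧ algebraMap K L b * ζ = -(ζ - 1) ^ 2 ∧ finrank K L ∣ 2 := by
  let _ : Algebra K ℂ := (Complex.ofRealHom.comp ι).toAlgebra
  have hmap : ∀ x, algebraMap K ℂ x = (ι x : ℂ) := fun _ => rfl
  let ζ : ℂ := Complex.exp (2 * Real.pi * Complex.I / k)
  have hζ : IsPrimitiveRoot ζ k := Complex.isPrimitiveRoot_exp k (by lia)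
  have hζ0 : ζ ≠ 0 := Complex.exp_ne_zero _
  have hb' : (ι b : ℂ) * ζ = -(ζ - 1) ^ 2 := by
    have h1 : (ι b : ℂ) = 2 - (ζ + ζ⁻¹) := by
      have h2 : ι b = 2 - 2 * Real.cos (2 * (Real.pi / k)) := by
        rw [hb, Real.cos_two_mul]; ring
      rw [h2]
      push_cast
      rw [Complex.two_cos, ← Complex.exp_neg, neg_mul,
        show 2 * ((Real.pi : ℂ) / k) * Complex.I = 2 * Real.pi * Complex.I / k by ring]
    rw [h1]
    field_simp
    ring
  have hquad : aeval ζ (X ^ 2 - C (2 - b) * X + 1 : K[X]) = 0 := by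
    simp only [map_add, map_sub, map_mul, map_pow, aeval_X, aeval_C, map_one, hmap, map_ofNat]
    linear_combination hb'
  have hmonic : (X ^ 2 - C (2 - b) * X + 1 : K[X]).Monic := by monicity!
  have hint : IsIntegral K ζ := ⟨_, hmonic, hquad⟩
  have hfin : FiniteDimensional K (IntermediateField.adjoin K {ζ}) :=
    IntermediateField.adjoin.finiteDimensional hint
  have hdeg : finrank K (IntermediateField.adjoin K {ζ}) ∣ 2 := by
    rw [IntermediateField.adjoin.finrank hint]
    have h1 := natDegree_le_of_dvd (minpoly.dvd K ζ hquad) hmonic.ne_zero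
    have h2 : (X ^ 2 - C (2 - b) * X + 1 : K[X]).natDegree = 2 := by compute_degree!
    have h3 := minpoly.natDegree_pos hint
    rw [h2] at h1
    interval_cases (minpoly K ζ).natDegree <;> norm_num
  have hnf : NumberField (IntermediateField.adjoin K {ζ}) :=
    { to_charZero := inferInstance
      to_finiteDimensional := FiniteDimensional.trans ℚ K _ }
  let ζ' := IntermediateField.AdjoinSimple.gen K ζ
  have hζ' : algebraMap (IntermediateField.adjoin K {ζ}) ℂ ζ' = ζ :=
    IntermediateField.AdjoinSimple.algebraMap_gen K ζ
  refine ⟨IntermediateField.adjoin K {ζ}, inferInstance, hnf, inferInstance, ζ', ?_, ?_, hdeg⟩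
  · refine IsPrimitiveRoot.of_map_of_injective
      (f := algebraMap (IntermediateField.adjoin K {ζ}) ℂ) ?_
      (algebraMap (IntermediateField.adjoin K {ζ}) ℂ).injective
    rwa [hζ']
  · apply (algebraMap (IntermediateField.adjoin K {ζ}) ℂ).injective
    rw [map_mul, map_neg, map_pow, map_sub, map_one, hζ', ← IsScalarTower.algebraMap_apply, hmap,
      hb']

/-- The norm of `4 sin² (π / k)` from a number field `K` containing it. -/
theorem abs_norm_pow_totient {K : Type*} [Field K] [NumberField K] (ι : K →+* ℝ) {k : ℕ}
    (hk : 2 < k) {b : K} (hb : ι b = 4 - (2 * Real.cos (Real.pi / k)) ^ 2) :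
    |((Algebra.norm ℚ b : ℚ) : ℝ)| ^ k.totient =
      |(((cyclotomic k ℤ).eval 1 : ℤ) : ℝ)| ^ (2 * finrank ℚ K) := by
  obtain ⟨L, _, _, _, ζ, hζ, hbζ, -⟩ := exists_cyclotomic_extension ι hk hb
  exact_mod_cast (abs_norm_pow_totient_of_cyclotomic hk hζ hbζ).1

/-- This confines `k` in terms of the degree, and gives the divisibility of the degree for the
orders 5, 7 and 11. -/
theorem totient_dvd_two_mul_finrank {K : Type*} [Field K] [NumberField K] (ι : K →+* ℝ) {k : ℕ}
    (hk : 2 < k) {b : K} (hb : ι b = 4 - (2 * Real.cos (Real.pi / k)) ^ 2) :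
    k.totient ∣ 2 * finrank ℚ K := by
  obtain ⟨L, _, _, _, ζ, hζ, hbζ, h2⟩ := exists_cyclotomic_extension ι hk hb
  exact (Dvd.intro_left _ (abs_norm_pow_totient_of_cyclotomic hk hζ hbζ).2.symm).trans
    (mul_dvd_mul_right h2 _)

end CyclotomicNorm

/-! ### From V-arithmetic graphs to inequalities in the ground field -/

section EdgeField

open Module NumberField

/-- The arithmetic data that a V-arithmetic edge graph of type `Γ₅⁽⁴⁾` gives on its ground field:
`t = u²`, `a = 4 sin² (π / s)` and `b = 4 sin² (π / k)` in a number field `K` with a distinguished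
real embedding `ι`, and the inequalities that hold under all the other real embeddings. -/
structure IsEdgeField {K : Type*} [Field K] (ι : K →+* ℝ) (s k : ℕ) (t a b : K) :
    Prop where
  isIntegral_t : IsIntegral ℤ t
  isIntegral_a : IsIntegral ℤ a
  isIntegral_b : IsIntegral ℤ b
  three_le_s : 3 ≤ s
  three_le_k : 3 ≤ k
  four_lt : 4 < ι t
  lt_max : ι t < 196
  apply_a : ι a = 4 - (2 * Real.cos (Real.pi / s)) ^ 2
  apply_b : ι b = 4 - (2 * Real.cos (Real.pi / k)) ^ 2
  nonneg_t : ∀ τ : K →+* ℝ, τ ≠ ι → 0 ≤ τ t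
  nonneg_a : ∀ τ : K →+* ℝ, τ ≠ ι → 0 ≤ τ a
  nonneg_b : ∀ τ : K →+* ℝ, τ ≠ ι → 0 ≤ τ b
  a_le : ∀ τ : K →+* ℝ, τ ≠ ι → τ a ≤ 4
  b_le : ∀ τ : K →+* ℝ, τ ≠ ι → τ b ≤ 4
  t_le : ∀ τ : K →+* ℝ, τ ≠ ι → 4 * τ t ≤ τ a * τ b

namespace IsEdgeField

variable {K : Type*} [Field K] {ι : K →+* ℝ} {s k : ℕ} {t a b : K}

theorem symm (h : IsEdgeField ι s k t a b) : IsEdgeField ι k s t b a where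
  isIntegral_t := h.isIntegral_t
  isIntegral_a := h.isIntegral_b
  isIntegral_b := h.isIntegral_a
  three_le_s := h.three_le_k
  three_le_k := h.three_le_s
  four_lt := h.four_lt
  lt_max := h.lt_max
  apply_a := h.apply_b
  apply_b := h.apply_a
  nonneg_t := h.nonneg_t
  nonneg_a := h.nonneg_b
  nonneg_b := h.nonneg_a
  a_le := h.b_le
  b_le := h.a_le
  t_le τ hτ := (h.t_le τ hτ).trans_eq (mul_comm _ _)

end IsEdgeField

/-- Negative definite modulo the kernel means negative semidefinite, so each inequality follows from
evaluating the form at one vector. -/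
theorem nonneg_of_isNegDefModKernel_gamma {α u β : ℝ}
    (h : IsNegDefModKernel (!![-2, α, 0, 0; α, -2, u, 0; 0, u, -2, β; 0, 0, β, -2])) :
    0 ≤ 4 - α ^ 2 ∧ 0 ≤ 4 - β ^ 2 ∧
      (4 - α ^ 2 ≠ 0 → 4 * u ^ 2 ≤ (4 - α ^ 2) * (4 - β ^ 2)) := by
  have key : ∀ x y z w : ℝ, -2 * x ^ 2 - 2 * y ^ 2 - 2 * z ^ 2 - 2 * w ^ 2 + 2 * α * x * y +
      2 * u * y * z + 2 * β * z * w ≤ 0 := by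
    intro x y z w
    by_cases hx : (!![-2, α, 0, 0; α, -2, u, 0; 0, u, -2, β; 0, 0, β, -2] : Matrix _ _ ℝ) *ᵥ
        ![x, y, z, w] = 0
    · have h0 := congrArg (fun v => ![x, y, z, w] ⬝ᵥ v) hx
      simp [Matrix.mulVec, dotProduct, Fin.sum_univ_four] at h0
      nlinarith
    · have h0 := h _ hx
      simp [Matrix.mulVec, dotProduct, Fin.sum_univ_four] at h0
      nlinarith
  have ha : 0 ≤ 4 - α ^ 2 := by nlinarith [key (α / 2) 1 0 0]
  refine ⟨ha, by nlinarith [key 0 0 1 (β / 2)], fun hne => ?_⟩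
  have hpos : 0 < 4 - α ^ 2 := lt_of_le_of_ne ha hne.symm
  -- For fixed middle coordinates `y`, `z` the form is largest at `x = αy/2`, `w = βz/2`. The choice
  -- `y = 2u`, `z = 4 - α²` makes the remaining binary form a multiple of its discriminant
  -- condition.
  have h1 := key (α * (2 * u) / 2) (2 * u) (4 - α ^ 2) (β * (4 - α ^ 2) / 2)
  have h2 : (4 - α ^ 2) * (4 * u ^ 2) ≤ (4 - α ^ 2) * ((4 - α ^ 2) * (4 - β ^ 2)) := by nlinarith
  exact le_of_mul_le_mul_left h2 hpos

theorem groundField_le_entryField {ι : Type*} (A : Matrix ι ι ℝ) :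
    groundField A ≤ entryField A := by
  rw [groundField, IntermediateField.adjoin_le_iff]
  rintro x ⟨m, i, rfl⟩
  exact prod_mem fun j _ => mem_entryField A _ _

theorem mul_self_mem_groundField {ι : Type*} (A : Matrix ι ι ℝ) (hA : A.IsSymm) (i j : ι) :
    A i j ^ 2 ∈ groundField A := by
  refine IntermediateField.subset_adjoin ℚ _ ⟨1, ![i, j], ?_⟩
  simp [cyclicProduct, Fin.prod_univ_two, pow_two, hA.apply]

theorem IsVArithmetic.isIntegral_sq {ι : Type*} [Fintype ι] [DecidableEq ι] {A : Matrix ι ι ℝ}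
    (hA : IsVArithmetic A) (i j : ι) : IsIntegral ℤ (A i j ^ 2) := by
  have := hA.integral 1 ![i, j]
  simpa [cyclicProduct, Fin.prod_univ_two, pow_two, hA.fundamental.symm.apply] using this

theorem finiteDimensional_groundField {ι : Type*} [Fintype ι] [DecidableEq ι] {A : Matrix ι ι ℝ}
    (hA : IsVArithmetic A) : FiniteDimensional ℚ (groundField A) := by
  have := hA.numberField
  exact FiniteDimensional.of_injective
    (IntermediateField.inclusion (groundField_le_entryField A)).toLinearMap
    (IntermediateField.inclusion (groundField_le_entryField A)).injective

theorem numberField_groundField {ι : Type*} [Fintype ι] [DecidableEq ι] {A : Matrix ι ι ℝ}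
    (hA : IsVArithmetic A) : NumberField (groundField A) where
  to_charZero := inferInstance
  to_finiteDimensional := finiteDimensional_groundField hA

/-- Arithmeticity speaks of embeddings of the entry field, while norms are taken from the ground
field. An embedding extends to `ℂ` by algebraicity, and the extension is real because the entry
field is totally real. -/
theorem exists_extension_entryField {ι : Type*} [Fintype ι] [DecidableEq ι] {A : Matrix ι ι ℝ}
    (hA : IsVArithmetic A) (τ : groundField A →+* ℝ) :
    ∃ σ : entryField A →+* ℝ, ∀ x : groundField A,
      σ (IntermediateField.inclusion (groundField_le_entryField A) x) = τ x := by
  have := hA.numberField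
  have := hA.totallyReal
  let i : groundField A →+* entryField A :=
    (IntermediateField.inclusion (groundField_le_entryField A)).toRingHom
  let _ : Algebra (groundField A) (entryField A) := i.toAlgebra
  let _ : Algebra (groundField A) ℂ := (Complex.ofRealHom.comp τ).toAlgebra
  have : IsScalarTower ℚ (groundField A) (entryField A) :=
    IsScalarTower.of_algebraMap_eq fun q => by simp
  have : Algebra.IsAlgebraic (groundField A) (entryField A) := Algebra.IsAlgebraic.tower_top (K := ℚ) _
  let φ : entryField A →ₐ[groundField A] ℂ := IsAlgClosed.lift
  obtain ⟨σ, hσ⟩ := exists_real_embedding (φ : entryField A →+* ℂ)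
  refine ⟨σ, fun x => ?_⟩
  have h1 : ((σ (i x) : ℝ) : ℂ) = (τ x : ℂ) := by
    rw [← hσ]
    exact φ.commutes x
  exact_mod_cast h1

theorem isTotallyReal_groundField {ι : Type*} [Fintype ι] [DecidableEq ι] {A : Matrix ι ι ℝ}
    (hA : IsVArithmetic A) : IsTotallyReal (groundField A) := by
  have := hA.numberField
  have := hA.totallyReal
  let i : groundField A →+* entryField A :=
    (IntermediateField.inclusion (groundField_le_entryField A)).toRingHom
  let _ : Algebra (groundField A) (entryField A) := i.toAlgebra
  have : IsScalarTower ℚ (groundField A) (entryField A) :=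
    IsScalarTower.of_algebraMap_eq fun q => by simp
  have : Algebra.IsAlgebraic (groundField A) (entryField A) := Algebra.IsAlgebraic.tower_top (K := ℚ) _
  exact IsTotallyReal.of_algebra (groundField A) (entryField A)

theorem two_mul_cos_sq_lt_four {s : ℕ} (hs : 3 ≤ s) : (2 * Real.cos (Real.pi / s)) ^ 2 < 4 := by
  have hs' : (3 : ℝ) ≤ s := by exact_mod_cast hs
  have h1 : 0 < Real.sin (Real.pi / s) :=
    Real.sin_pos_of_pos_of_lt_pi (by positivity) (div_lt_self Real.pi_pos (by linarith))
  nlinarith [Real.sin_sq_add_cos_sq (Real.pi / s)]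

theorem isEdgeField_groundField {s k : ℕ} (hs : 3 ≤ s) (hk : 3 ≤ k)
    {A : Matrix (Fin 4) (Fin 4) ℝ} (hA : A ∈ gamma5Graphs 14 s k) :
    ∃ t a b : groundField A, IsEdgeField (groundField A).val.toRingHom s k t a b := by
  obtain ⟨⟨u, hu, hAu⟩, hV, -, -, hmin⟩ := hA
  have hsymm := hV.fundamental.symm
  have h01 : A 0 1 = 2 * Real.cos (Real.pi / s) := by simp [hAu, gamma5Matrix]
  have h12 : A 1 2 = u := by simp [hAu, gamma5Matrix]
  have h23 : A 2 3 = 2 * Real.cos (Real.pi / k) := by simp [hAu, gamma5Matrix]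
  have hu14 : u < 14 := h12 ▸ hmin 1 2
  let t : groundField A := ⟨A 1 2 ^ 2, mul_self_mem_groundField A hsymm 1 2⟩
  let α : groundField A := ⟨A 0 1 ^ 2, mul_self_mem_groundField A hsymm 0 1⟩
  let β : groundField A := ⟨A 2 3 ^ 2, mul_self_mem_groundField A hsymm 2 3⟩
  have inj : Function.Injective (algebraMap (groundField A) ℝ) :=
    (algebraMap (groundField A) ℝ).injective
  have hint : ∀ x : groundField A, IsIntegral ℤ (x : ℝ) → IsIntegral ℤ x := fun x hx =>
    (isIntegral_algebraMap_iff (B := ℝ) inj).1 hx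
  have h4 : IsIntegral ℤ (4 : groundField A) := by
    simpa using isIntegral_algebraMap (R := ℤ) (A := groundField A) (x := 4)
  have key : ∀ τ : groundField A →+* ℝ, τ ≠ (groundField A).val.toRingHom →
      0 ≤ τ t ∧ 0 ≤ τ α ∧ 0 ≤ τ β ∧ 0 ≤ 4 - τ α ∧ 0 ≤ 4 - τ β ∧
        (4 - τ α ≠ 0 → 4 * τ t ≤ (4 - τ α) * (4 - τ β)) := by
    intro τ hτ
    obtain ⟨σ, hσ⟩ := exists_extension_entryField hV τ
    have hne : ∃ x : entryField A, (x : ℝ) ∈ groundField A ∧ σ x ≠ (x : ℝ) := by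
      by_contra! hcon
      refine hτ (RingHom.ext fun x => ?_)
      rw [← hσ x]
      exact hcon _ x.2
    have hneg := hV.negDef σ hne
    let c : Fin 4 → Fin 4 → ℝ := fun i j => σ ⟨A i j, mem_entryField A i j⟩
    have hval : ∀ i j (q : ℚ), A i j = q → c i j = q := by
      intro i j q hq
      have : (⟨A i j, mem_entryField A i j⟩ : entryField A) = (q : entryField A) :=
        Subtype.ext (by simpa using hq)
      simp [c, this]
    have hcs : ∀ i j, c i j = c j i := fun i j => by
      simp only [c]; congr 2; exact (hsymm.apply i j).symm
    have hsq : ∀ i j, τ ⟨A i j ^ 2, mul_self_mem_groundField A hsymm i j⟩ = c i j ^ 2 := by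
      intro i j
      rw [← hσ, ← map_pow]
      rfl
    have hmat : conjMatrix A σ = !![-2, c 0 1, 0, 0; c 0 1, -2, c 1 2, 0;
        0, c 1 2, -2, c 2 3; 0, 0, c 2 3, -2] := by
      ext i j
      have : conjMatrix A σ i j = c i j := rfl
      rw [this]
      fin_cases i <;> fin_cases j <;> simp
      all_goals first
        | exact hcs _ _
        | (refine (hval _ _ (-2) ?_).trans ?_ <;> simp [hAu, gamma5Matrix]; done)
        | (refine (hval _ _ 0 ?_).trans ?_ <;> simp [hAu, gamma5Matrix])
    rw [hmat] at hneg
    obtain ⟨h1, h2, h3⟩ := nonneg_of_isNegDefModKernel_gamma hneg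
    simp only [t, α, β, hsq]
    exact ⟨by positivity, by positivity, by positivity, h1, h2, h3⟩
  have e4 : ((4 : groundField A) : ℝ) = 4 := rfl
  have e4' : ∀ τ : groundField A →+* ℝ, τ 4 = 4 := fun τ => map_ofNat τ 4
  -- The product inequality was obtained only where `4 - τ α ≠ 0`; this holds at every embedding
  -- because it holds in the field.
  have hα4 : (4 - α : groundField A) ≠ 0 := by
    intro h0
    have h1 := congrArg (fun x : groundField A => (x : ℝ)) h0
    have h2 := two_mul_cos_sq_lt_four hs
    simp [α, h01, e4] at h1
    linarith
  refine ⟨t, 4 - α, 4 - β, ?_⟩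
  exact
    { isIntegral_t := hint _ (hV.isIntegral_sq 1 2)
      isIntegral_a := h4.sub (hint _ (hV.isIntegral_sq 0 1))
      isIntegral_b := h4.sub (hint _ (hV.isIntegral_sq 2 3))
      three_le_s := hs
      three_le_k := hk
      four_lt := by
        change 4 < A 1 2 ^ 2
        rw [h12]; nlinarith
      lt_max := by
        change A 1 2 ^ 2 < 196
        rw [h12]; nlinarith
      apply_a := by
        change ((4 - α : groundField A) : ℝ) = _
        simp [α, h01, e4]
      apply_b := by
        change ((4 - β : groundField A) : ℝ) = _
        simp [β, h23, e4]
      nonneg_t := fun τ hτ => (key τ hτ).1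
      nonneg_a := fun τ hτ => by simpa [e4'] using (key τ hτ).2.2.2.1
      nonneg_b := fun τ hτ => by simpa [e4'] using (key τ hτ).2.2.2.2.1
      a_le := fun τ hτ => by simpa [e4'] using (key τ hτ).2.1
      b_le := fun τ hτ => by simpa [e4'] using (key τ hτ).2.2.1
      t_le := fun τ hτ => by
        have h := (key τ hτ).2.2.2.2.2 (by
          have := (map_ne_zero τ).2 hα4
          simpa [e4'] using this)
        simpa [e4'] using h }

end EdgeField

/-! ### Bounding the norm of `b` by `0.45 · 1.75^N · ι b` -/

section NormBound

open Module Polynomial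

/-- The quotient `n² / φ(n)³` at a power of `p` is largest for `p` itself, where it is `p²/(p-1)³`:
4 for `p = 2`, `9/8` for `p = 3`, and below 1 for larger primes. -/
theorem sq_le_mul_totient_cube_prime_pow {p : ℕ} (hp : p.Prime) (m : ℕ) :
    ((p ^ (m + 1) : ℕ) : ℚ) ^ 2 ≤ (if 2 ∣ p ^ (m + 1) then 4 else 1) *
      (if 3 ∣ p ^ (m + 1) then 9 / 8 else 1) * ((p ^ (m + 1)).totient : ℚ) ^ 3 := by
  have key : ∀ c : ℚ, (p : ℚ) ^ 2 ≤ c * ((p : ℚ) - 1) ^ 3 →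
      ((p ^ (m + 1) : ℕ) : ℚ) ^ 2 ≤ c * ((p ^ (m + 1)).totient : ℚ) ^ 3 := by
    intro c hc
    have hp1 : (1 : ℚ) ≤ p := by exact_mod_cast hp.one_le
    rw [Nat.totient_prime_pow_succ hp]
    push_cast [hp.one_le]
    calc ((p : ℚ) ^ (m + 1)) ^ 2 = ((p : ℚ) ^ m) ^ 2 * p ^ 2 := by ring
      _ ≤ ((p : ℚ) ^ m) ^ 3 * (c * ((p : ℚ) - 1) ^ 3) := by
        refine mul_le_mul (pow_le_pow_right₀ (one_le_pow₀ hp1) (by norm_num)) hc (by positivity)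
          (by positivity)
      _ = _ := by ring
  refine key _ ?_
  have h2 : 2 ∣ p ^ (m + 1) ↔ 2 = p := ⟨fun h =>
    (Nat.prime_dvd_prime_iff_eq Nat.prime_two hp).1 (Nat.prime_two.dvd_of_dvd_pow h),
    fun h => h ▸ dvd_pow_self _ (by lia)⟩
  have h3 : 3 ∣ p ^ (m + 1) ↔ 3 = p := ⟨fun h =>
    (Nat.prime_dvd_prime_iff_eq Nat.prime_three hp).1 (Nat.prime_three.dvd_of_dvd_pow h),
    fun h => h ▸ dvd_pow_self _ (by lia)⟩
  simp only [h2, h3]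
  by_cases hp2 : 2 = p
  · subst hp2; norm_num
  by_cases hp3 : 3 = p
  · subst hp3; norm_num
  have : 4 ≤ p := by have := hp.two_le; lia
  have h4 : (4 : ℚ) ≤ p := by exact_mod_cast this
  simp only [hp2, hp3, if_false]
  nlinarith [mul_nonneg (sub_nonneg.2 h4) (sub_nonneg.2 h4)]

/-- The quotient `n² / φ(n)³` is multiplicative, and only the primes 2 and 3 contribute more than 1;
`9/2 = 4 · 9/8`. -/
theorem sq_le_mul_totient_cube {n : ℕ} (hn : 0 < n) : 2 * n ^ 2 ≤ 9 * n.totient ^ 3 := by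
  have key : ∀ n : ℕ, 0 < n → (n : ℚ) ^ 2 ≤ (if 2 ∣ n then 4 else 1) *
      (if 3 ∣ n then 9 / 8 else 1) * (n.totient : ℚ) ^ 3 := by
    intro n
    induction n using Nat.recOnPosPrimePosCoprime with
    | prime_pow p r hp hr =>
      intro _
      obtain ⟨m, rfl⟩ : ∃ m, r = m + 1 := ⟨r - 1, by lia⟩
      exact sq_le_mul_totient_cube_prime_pow hp m
    | zero => simp
    | one => simp
    | coprime a b ha hb hab iha ihb =>
      intro _
      have h1 := mul_le_mul (iha (by lia)) (ihb (by lia)) (by positivity) (by positivity)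
      have h2 : ∀ q : ℕ, q.Prime → ∀ c : ℚ, (if q ∣ a * b then c else 1) =
          (if q ∣ a then c else 1) * (if q ∣ b then c else 1) := by
        intro q hq c
        simp only [hq.dvd_mul]
        by_cases h : q ∣ a
        · have : ¬ q ∣ b := fun h' => hq.one_lt.ne' (Nat.eq_one_of_dvd_coprimes hab h h')
          simp [h, this]
        · simp [h]
      rw [h2 2 Nat.prime_two, h2 3 Nat.prime_three, Nat.totient_mul hab]
      push_cast
      calc _ = (a : ℚ) ^ 2 * b ^ 2 := by ring
        _ ≤ _ := h1
        _ = _ := by ring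
  have h1 : (if 2 ∣ n then 4 else 1) * (if 3 ∣ n then 9 / 8 else 1) ≤ (9 / 2 : ℚ) := by
    split_ifs <;> norm_num
  have h2 : (n : ℚ) ^ 2 ≤ 9 / 2 * (n.totient : ℚ) ^ 3 :=
    (key n hn).trans (mul_le_mul_of_nonneg_right h1 (by positivity))
  have h3 : (2 : ℚ) * n ^ 2 ≤ 9 * n.totient ^ 3 := by linarith
  exact_mod_cast h3

theorem sixteen_le_mul_sq {k : ℕ} (hk : 2 ≤ k) :
    16 ≤ (4 - (2 * Real.cos (Real.pi / k)) ^ 2) * (k : ℝ) ^ 2 := by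
  have hk' : (2 : ℝ) ≤ k := by exact_mod_cast hk
  have h1 := Real.mul_le_sin (x := Real.pi / k) (by positivity)
    (div_le_div_of_nonneg_left Real.pi_pos.le two_pos hk')
  have h2 : 2 / Real.pi * (Real.pi / k) = 2 / k := by field_simp
  rw [h2, div_le_iff₀ (by linarith)] at h1
  nlinarith [Real.sin_sq_add_cos_sq (Real.pi / k)]

/-- The limit of the right side is `4π² ≈ 39.5`; the cubic lower bound for the sine comes close to
it, where Jordan's inequality gives only 16. -/
theorem thirtyEight_le_mul_sq {k : ℕ} (hk : 11 ≤ k) :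
    38 ≤ (4 - (2 * Real.cos (Real.pi / k)) ^ 2) * (k : ℝ) ^ 2 := by
  have hk' : (11 : ℝ) ≤ k := by exact_mod_cast hk
  set y := Real.pi / k with hy
  have hy0 : 0 < y := by positivity
  have hyk : y * k = Real.pi := by rw [hy]; field_simp
  have hy1 : y ≤ 0.2864 := by
    rw [hy, div_le_iff₀ (by linarith)]
    nlinarith [Real.pi_lt_d2]
  have h1 := Real.sin_gt_sub_cube hy0
  have hy2 : y ^ 2 ≤ 0.0821 := by nlinarith
  have h2 : 0.986 * y ≤ Real.sin y := by nlinarith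
  have h3 : 0.986 * 3.14 ≤ Real.sin y * k := by nlinarith [Real.pi_gt_d2]
  nlinarith [Real.sin_sq_add_cos_sq y]

theorem eval_one_cyclotomic_cases {k : ℕ} (hk : 2 ≤ k) :
    (cyclotomic k ℤ).eval 1 = 1 ∨
      ∃ p r : ℕ, p.Prime ∧ k = p ^ (r + 1) ∧ (cyclotomic k ℤ).eval 1 = p := by
  by_cases h : ∀ {p : ℕ}, p.Prime → ∀ r : ℕ, p ^ r ≠ k
  · exact Or.inl (eval_one_cyclotomic_not_prime_pow h)
  · push Not at h
    obtain ⟨p, hp, r, hr⟩ := h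
    obtain ⟨r, rfl⟩ : ∃ r', r = r' + 1 := Nat.exists_eq_succ_of_ne_zero (by rintro rfl; simp at hr; lia)
    have : Fact p.Prime := ⟨hp⟩
    exact Or.inr ⟨p, r, hp, hr.symm, by rw [← hr, eval_one_cyclotomic_prime_pow]⟩

theorem mul_pow_le_mul_pow {R G A B : ℝ} {n N : ℕ} (hG : 0 ≤ G) (hGB : G ≤ B) (hA : 0 ≤ A)
    (h : R * G ^ n ≤ A * B ^ n) (hN : n ≤ N) : R * G ^ N ≤ A * B ^ N := by
  obtain ⟨m, rfl⟩ := Nat.exists_eq_add_of_le hN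
  rw [pow_add, pow_add, ← mul_assoc, ← mul_assoc]
  exact mul_le_mul h (pow_le_pow_left₀ hG hGB m) (by positivity)
    (mul_nonneg hA (pow_nonneg (hG.trans hGB) n))

theorem five_mul_cube_le {N : ℕ} (hN : 21 ≤ N) : 5 * (N : ℝ) ^ 3 ≤ 1.75 ^ N := by
  induction N, hN using Nat.le_induction with
  | base => norm_num
  | succ n hn ih =>
    have : (21 : ℝ) ≤ n := by exact_mod_cast hn
    have h1 : ((n : ℝ) + 1) ^ 3 ≤ 1.75 * (n : ℝ) ^ 3 := by
      nlinarith [mul_nonneg (sub_nonneg.2 this) (sq_nonneg (n : ℝ))]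
    calc 5 * ((n + 1 : ℕ) : ℝ) ^ 3 = 5 * ((n : ℝ) + 1) ^ 3 := by push_cast; ring
      _ ≤ 1.75 * (5 * (n : ℝ) ^ 3) := by linarith
      _ ≤ 1.75 * 1.75 ^ n := by gcongr
      _ = _ := (pow_succ' _ _).symm

theorem sixteen_mul_sq_mul_pow_le {N : ℕ} (hN : 21 ≤ N) :
    16 * (N : ℝ) ^ 2 * 1.28 ^ N ≤ 17.1 * 1.75 ^ N := by
  induction N, hN using Nat.le_induction with
  | base => norm_num
  | succ n hn ih =>
    have h21 : (21 : ℝ) ≤ n := by exact_mod_cast hn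
    have h1 : 1.28 * ((n : ℝ) + 1) ^ 2 ≤ 1.75 * (n : ℝ) ^ 2 := by nlinarith
    have h2 : (0 : ℝ) < 1.28 ^ n := by positivity
    calc 16 * ((n + 1 : ℕ) : ℝ) ^ 2 * 1.28 ^ (n + 1)
        = 16 * 1.28 ^ n * (1.28 * ((n : ℝ) + 1) ^ 2) := by push_cast; ring
      _ ≤ 16 * 1.28 ^ n * (1.75 * (n : ℝ) ^ 2) := by gcongr
      _ = 1.75 * (16 * (n : ℝ) ^ 2 * 1.28 ^ n) := by ring
      _ ≤ 1.75 * (17.1 * 1.75 ^ n) := by gcongr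
      _ = _ := by ring

theorem sq_le_pow_pred {p : ℕ} (hp : 29 ≤ p) : (p : ℝ) ^ 2 ≤ 1.28 ^ (p - 1) := by
  induction p, hp using Nat.le_induction with
  | base => norm_num
  | succ n hn ih =>
    have h29 : (29 : ℝ) ≤ n := by exact_mod_cast hn
    obtain ⟨m, rfl⟩ : ∃ m, n = m + 1 := ⟨n - 1, by lia⟩
    simp only [Nat.add_sub_cancel] at ih ⊢
    rw [pow_succ (1.28 : ℝ)]
    push_cast at *
    have h1 : ((m : ℝ) + 1 + 1) ^ 2 ≤ 1.28 * ((m : ℝ) + 1) ^ 2 := by nlinarith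
    linarith

theorem two_mul_le_pow {n : ℕ} (hn : 14 ≤ n) : 2 * (n : ℝ) ≤ 1.28 ^ n := by
  induction n, hn using Nat.le_induction with
  | base => norm_num
  | succ n hn ih =>
    have h14 : (14 : ℝ) ≤ n := by exact_mod_cast hn
    rw [pow_succ]
    push_cast
    nlinarith

theorem le_two_mul_totient_prime_pow {p r : ℕ} (hp : p.Prime) :
    p ^ (r + 1) ≤ 2 * (p ^ (r + 1)).totient := by
  rw [Nat.totient_prime_pow_succ hp, pow_succ]
  have := hp.two_le
  calc p ^ r * p ≤ p ^ r * (2 * (p - 1)) := by gcongr; lia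
    _ = _ := by ring

/-- For a prime the exponent is `p - 1 ≥ 28`. For a proper power `p² ≤ k ≤ 2 φ(k)`, with `φ(k) ≥
14`. -/
theorem sq_le_pow_totient_prime_pow {p r : ℕ} (hp : p.Prime) (hk : 27 ≤ p ^ (r + 1)) :
    (p : ℝ) ^ 2 ≤ 1.28 ^ (p ^ (r + 1)).totient := by
  have h2 := le_two_mul_totient_prime_pow (r := r) hp
  rcases Nat.eq_zero_or_pos r with rfl | hr
  · rw [zero_add, pow_one] at *
    rw [Nat.totient_prime hp]
    refine sq_le_pow_pred ?_
    by_contra! h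
    interval_cases p <;> revert hp <;> decide
  · refine le_trans ?_ (two_mul_le_pow (by lia))
    have : p ^ 2 ≤ p ^ (r + 1) := Nat.pow_le_pow_right hp.pos (by lia)
    exact_mod_cast this.trans h2

variable {K : Type*} [Field K] [NumberField K] {ι : K →+* ℝ} {k : ℕ} {b : K}

theorem abs_norm_le_pow (hk : 2 < k) (hb : ι b = 4 - (2 * Real.cos (Real.pi / k)) ^ 2) {G : ℝ}
    (hG : 0 ≤ G) (h : (((cyclotomic k ℤ).eval 1 : ℤ) : ℝ) ^ 2 ≤ G ^ k.totient) :
    |((Algebra.norm ℚ b : ℚ) : ℝ)| ≤ G ^ finrank ℚ K := by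
  have hφ : k.totient ≠ 0 := (Nat.totient_pos.2 (by lia)).ne'
  rw [← pow_le_pow_iff_left₀ (abs_nonneg _) (by positivity) hφ, abs_norm_pow_totient ι hk hb,
    pow_mul, sq_abs, ← pow_mul G, mul_comm, pow_mul G]
  exact pow_le_pow_left₀ (by positivity) h _

/-- It suffices to find `R ≥ 1 / ι b` and `G` with `Φ_k(1)² ≤ G^φ(k)`, so that `|N(b)| ≤ G^N`, and
to compare `R G^N` with `0.45 · 1.75^N`. -/
theorem abs_norm_le_mul_apply (hk : 8 ≤ k ∨ k = 6)
    (hb : ι b = 4 - (2 * Real.cos (Real.pi / k)) ^ 2) (hN : 21 ≤ finrank ℚ K) :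
    |((Algebra.norm ℚ b : ℚ) : ℝ)| ≤ 0.45 * 1.75 ^ finrank ℚ K * ι b := by
  set N := finrank ℚ K with hNdef
  have hk6 : 6 ≤ k := by lia
  have hdvd : k.totient ∣ 2 * N := totient_dvd_two_mul_finrank ι (by lia) hb
  have hφN : k.totient ≤ 2 * N := Nat.le_of_dvd (by lia) hdvd
  have hN' : (21 : ℝ) ≤ N := by exact_mod_cast hN
  have h16 := sixteen_le_mul_sq (k := k) (by lia)
  rw [← hb] at h16
  have hk0 : (0 : ℝ) < k := by exact_mod_cast (by lia : 0 < k)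
  have hb0 : 0 < ι b := by
    by_contra! h
    nlinarith [mul_nonneg (neg_nonneg.2 h) (sq_nonneg (k : ℝ))]
  have main : ∀ R G : ℝ, 0 ≤ G → 1 ≤ R * ι b →
      (((cyclotomic k ℤ).eval 1 : ℤ) : ℝ) ^ 2 ≤ G ^ k.totient → R * G ^ N ≤ 0.45 * 1.75 ^ N →
      |((Algebra.norm ℚ b : ℚ) : ℝ)| ≤ 0.45 * 1.75 ^ N * ι b := by
    intro R G hG hR h1 h2
    calc _ ≤ G ^ N := abs_norm_le_pow (by lia) hb hG h1
      _ ≤ G ^ N * (R * ι b) := le_mul_of_one_le_right (by positivity) hR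
      _ = R * G ^ N * ι b := by ring
      _ ≤ _ := by gcongr
  rcases eval_one_cyclotomic_cases (k := k) (by lia) with h1 | ⟨p, r, hp, hkp, h1⟩
  -- If `k` is not a prime power, `b` is a unit. Then `k² ≤ 36 N³`, so `k²/16 ≤ 2.25 N³ = 0.45 · 5
  -- N³`.
  · refine main (k ^ 2 / 16) 1 zero_le_one (by linarith) (by simp [h1]) ?_
    have h2 : 2 * (k : ℝ) ^ 2 ≤ 9 * (2 * N) ^ 3 := by
      have := (sq_le_mul_totient_cube (n := k) (by lia)).trans
        (Nat.mul_le_mul_left 9 (Nat.pow_le_pow_left hφN 3))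
      exact_mod_cast this
    have := five_mul_cube_le hN
    rw [one_pow]
    nlinarith
  have h2 := le_two_mul_totient_prime_pow (r := r) hp
  rw [← hkp] at h2
  rw [h1] at main
  have hpq : ∀ q : ℕ, q.Prime → q ∣ k → q = p := fun q hq h =>
    (Nat.prime_dvd_prime_iff_eq hq hp).1 (hq.dvd_of_dvd_pow (hkp ▸ h))
  have hp' : ∀ q : ℕ, q.Prime → q ∣ k → (((p : ℤ)) : ℝ) = q := fun q hq h => by
    rw [hpq q hq h]; rfl
  have small : ∀ (q : ℕ) (R G : ℝ) (n : ℕ), q.Prime → q ∣ k → 0 ≤ G ∧ G ≤ 1.75 → 1 ≤ R * ι b →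
      (q : ℝ) ^ 2 ≤ G ^ k.totient → n ≤ N → R * G ^ n ≤ 0.45 * 1.75 ^ n →
      |((Algebra.norm ℚ b : ℚ) : ℝ)| ≤ 0.45 * 1.75 ^ N * ι b := by
    intro q R G n hq hqk hG hR hqG hn h
    exact main R G hG.1 hR (by rwa [hp' q hq hqk])
      (mul_pow_le_mul_pow hG.1 hG.2 (by norm_num) h hn)
  rcases le_or_gt 27 k with h27 | h27
  · have h38 := thirtyEight_le_mul_sq (k := k) (by lia)
    rw [← hb] at h38
    -- Here `k ≤ 2 φ(k) ≤ 4N`, and `17.1 = 0.45 · 38` in the comparison that follows.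
    refine main (k ^ 2 / 38) 1.28 (by norm_num) (by linarith) ?_ ?_
    · rw [hkp, Int.cast_natCast]
      exact sq_le_pow_totient_prime_pow hp (hkp ▸ h27)
    · have h3 : (k : ℝ) ≤ 4 * N := by exact_mod_cast (by lia : k ≤ 4 * N)
      have h4 : (k : ℝ) ^ 2 ≤ 16 * (N : ℝ) ^ 2 := by nlinarith
      have h5 := sixteen_mul_sq_mul_pow_le hN
      have h6 : (0 : ℝ) < 1.28 ^ N := by positivity
      nlinarith [mul_le_mul_of_nonneg_right h4 h6.le]
  have h38 : 11 ≤ k → 38 ≤ ι b * (k : ℝ) ^ 2 := fun h => hb ▸ thirtyEight_le_mul_sq h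
  have two_three : ∀ q q' : ℕ, q.Prime → q'.Prime → q ∣ k → q' ∣ k → q = q' := fun q q' h h' hk hk' =>
    (hpq q h hk).trans (hpq q' h' hk').symm
  clear main hpq hp' hkp h1 hb hφN h2
  -- The value `11^(2/10) ≈ 1.6154` is so close to 1.75 that the comparison for `k = 11` is made
  -- from 25 on; `5 ∣ N` permits this.
  have h11 : k = 11 → 25 ≤ N := by
    rintro rfl
    rw [show Nat.totient 11 = 10 by decide] at hdvd
    lia
  have aux : ∀ x y : ℝ, x ≤ ι b * y → 0 < x → 1 ≤ y / x * ι b := fun x y h hx => by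
    rw [div_mul_eq_mul_div, le_div_iff₀ hx]; linarith
  rcases lt_or_ge k 16 with h16' | h16'
  · rcases hk with hk | hk
    · interval_cases k
      · exact small 2 _ 1.42 21 (by norm_num) (by norm_num) (by norm_num) (aux _ _ h16 (by norm_num))
          (by rw [show Nat.totient 8 = 4 by decide]; norm_num) hN (by norm_num)
      · exact small 3 _ 1.45 21 (by norm_num) (by norm_num) (by norm_num) (aux _ _ h16 (by norm_num))
          (by rw [show Nat.totient 9 = 6 by decide]; norm_num) hN (by norm_num)
      · exact absurd (two_three 2 5 (by norm_num) (by norm_num) (by norm_num) (by norm_num)) (by norm_num)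
      · exact small 11 _ 1.6155 25 (by norm_num) (by norm_num) (by norm_num)
          (aux _ _ (h38 (by norm_num)) (by norm_num))
          (by rw [show Nat.totient 11 = 10 by decide]; norm_num) (h11 rfl) (by norm_num)
      · exact absurd (two_three 2 3 (by norm_num) (by norm_num) (by norm_num) (by norm_num)) (by norm_num)
      · exact small 13 _ 1.54 21 (by norm_num) (by norm_num) (by norm_num)
          (aux _ _ (h38 (by norm_num)) (by norm_num))
          (by rw [show Nat.totient 13 = 12 by decide]; norm_num) hN (by norm_num)
      · exact absurd (two_three 2 7 (by norm_num) (by norm_num) (by norm_num) (by norm_num)) (by norm_num)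
      · exact absurd (two_three 3 5 (by norm_num) (by norm_num) (by norm_num) (by norm_num)) (by norm_num)
    · subst hk
      exact absurd (two_three 2 3 (by norm_num) (by norm_num) (by norm_num) (by norm_num)) (by norm_num)
  · have large : ∀ q : ℕ, q.Prime → q ∣ k → (q : ℝ) ^ 2 ≤ 1.426 ^ k.totient →
        |((Algebra.norm ℚ b : ℚ) : ℝ)| ≤ 0.45 * 1.75 ^ N * ι b := fun q hq hqk h =>
      small q (26 ^ 2 / 38) 1.426 21 hq hqk (by norm_num)
        (aux _ _ ((h38 (by lia)).trans (by
          have : (k : ℝ) ≤ 26 := by exact_mod_cast (by lia : k ≤ 26)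
          gcongr)) (by norm_num)) h hN (by norm_num)
    clear h38 h16 small h11 hdvd
    interval_cases k
    all_goals first
      | exact absurd (two_three 2 3 (by decide) (by decide) (by decide) (by decide)) (by decide)
      | exact absurd (two_three 2 5 (by decide) (by decide) (by decide) (by decide)) (by decide)
      | exact absurd (two_three 3 7 (by decide) (by decide) (by decide) (by decide)) (by decide)
      | exact absurd (two_three 2 11 (by decide) (by decide) (by decide) (by decide)) (by decide)
      | exact absurd (two_three 2 13 (by decide) (by decide) (by decide) (by decide)) (by decide)
      | skip
    · exact large 2 (by norm_num) (by norm_num) (by rw [show Nat.totient 16 = 8 by decide]; norm_num)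
    · exact large 17 (by norm_num) (by norm_num) (by rw [show Nat.totient 17 = 16 by decide]; norm_num)
    · exact large 19 (by norm_num) (by norm_num) (by rw [show Nat.totient 19 = 18 by decide]; norm_num)
    · exact large 23 (by norm_num) (by norm_num) (by rw [show Nat.totient 23 = 22 by decide]; norm_num)
    · exact large 5 (by norm_num) (by norm_num) (by rw [show Nat.totient 25 = 20 by decide]; norm_num)

end NormBound

/-! ### Suprema of the auxiliary polynomials -/

section PolynomialBounds

/-- Up to binomial factors these are the Bernstein basis polynomials on `[l, r]`. The bounds below
are certified by nonnegative combinations of them, on subintervals short enough for such a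
combination to exist. -/
theorem sub_pow_mul_sub_pow_nonneg {x l r : ℝ} (hl : l ≤ x) (hr : x ≤ r) (i j : ℕ) :
    0 ≤ (x - l) ^ i * (r - x) ^ j :=
  mul_nonneg (pow_nonneg (sub_nonneg.2 hl) i) (pow_nonneg (sub_nonneg.2 hr) j)

theorem abs_mul_sub_one_cube_le {x : ℝ} (h0 : 0 ≤ x) (h1 : x ≤ 3 / 2) :
    |x * (x - 1) ^ 3| ≤ 3 / 16 := by
  have key : ∀ l r, l ≤ x → x ≤ r → ∀ i j, 0 ≤ (x - l) ^ i * (r - x) ^ j := fun l r hl hr i j =>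
    sub_pow_mul_sub_pow_nonneg hl hr i j
  rw [abs_le]
  constructor
  · rcases le_total x (3 / 4) with h | h
    · have B := key _ _ h0 h
      linarith [B 0 4, B 1 3, B 2 2, B 3 1, B 4 0]
    · have B := key _ _ h h1
      linarith [B 0 4, B 1 3, B 2 2, B 3 1, B 4 0]
  · rcases le_total x (41 / 32) with h | h
    · have B := key _ _ h0 h
      linarith [B 0 4, B 1 3, B 2 2, B 3 1, B 4 0]
    · have B := key _ _ h h1
      linarith [B 0 4, B 1 3, B 2 2, B 3 1, B 4 0]

/-- On an interval of length below 4 there are integer polynomials with supremum below 1. This one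
vanishes at 0, 1, 2 and `(3 - √5)/2`, all in `[0, 9/4]`. -/
theorem abs_sextic_le {x : ℝ} (h0 : 0 ≤ x) (h1 : x ≤ 9 / 4) :
    |x * (x - 1) * (x - 2) ^ 2 * (x ^ 2 - 3 * x + 1)| ≤ 0.27 := by
  have key : ∀ l r, l ≤ x → x ≤ r → ∀ i j, 0 ≤ (x - l) ^ i * (r - x) ^ j := fun l r hl hr i j =>
    sub_pow_mul_sub_pow_nonneg hl hr i j
  rw [abs_le]
  constructor
  · rcases le_total x (7 / 32) with h | h
    · have B := key _ _ h0 h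
      linarith [B 0 6, B 1 5, B 2 4, B 3 3, B 4 2, B 5 1, B 6 0]
    rcases le_total x (91 / 64) with h' | h'
    · have B := key _ _ h h'
      linarith [B 0 6, B 1 5, B 2 4, B 3 3, B 4 2, B 5 1, B 6 0]
    · have B := key _ _ h' h1
      linarith [B 0 6, B 1 5, B 2 4, B 3 3, B 4 2, B 5 1, B 6 0]
  · rcases le_total x (51 / 64) with h | h
    · have B := key _ _ h0 h
      linarith [B 0 6, B 1 5, B 2 4, B 3 3, B 4 2, B 5 1, B 6 0]
    · have B := key _ _ h h1
      linarith [B 0 6, B 1 5, B 2 4, B 3 3, B 4 2, B 5 1, B 6 0]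

/-- Used for the quotient `t / b`, which lies in `[0, 3/4]`; a homogeneous form in `t` and `b` need
not be monic, so the roots may be rational. -/
theorem nonic_le {x : ℝ} (h0 : 0 ≤ x) (h1 : x ≤ 3 / 4) :
    x ^ 3 * (2 * x - 1) ^ 2 * (5 * x ^ 2 - 5 * x + 1) ^ 2 ≤ 1 / 2000 := by
  have key : ∀ l r, l ≤ x → x ≤ r → ∀ i j, 0 ≤ (x - l) ^ i * (r - x) ^ j := fun l r hl hr i j =>
    sub_pow_mul_sub_pow_nonneg hl hr i j
  rcases le_total x (11 / 32) with h | h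
  · have B := key _ _ h0 h
    linarith [B 0 9, B 1 8, B 2 7, B 3 6, B 4 5, B 5 4, B 6 3, B 7 2, B 8 1, B 9 0]
  rcases le_total x (41 / 64) with h' | h'
  · have B := key _ _ h h'
    linarith [B 0 9, B 1 8, B 2 7, B 3 6, B 4 5, B 5 4, B 6 3, B 7 2, B 8 1, B 9 0]
  · have B := key _ _ h' h1
    linarith [B 0 9, B 1 8, B 2 7, B 3 6, B 4 5, B 5 4, B 6 3, B 7 2, B 8 1, B 9 0]

theorem quadratic_roots {a : ℝ} (h : a ^ 2 - 5 * a + 5 = 0) :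
    1.3819 ≤ a ∧ a ≤ 1.382 ∨ 3.618 ≤ a ∧ a ≤ 3.6181 := by
  rcases le_total a 2.5 with h' | h'
  · left; constructor <;> nlinarith
  · right; constructor <;> nlinarith

/-- The roots are `4 sin²(jπ/7)` for `j = 1, 2, 3`. -/
theorem cubic_roots {a : ℝ} (h0 : 0 ≤ a) (h4 : a ≤ 4) (h : a ^ 3 - 7 * a ^ 2 + 14 * a - 7 = 0) :
    0.753 ≤ a ∧ a ≤ 0.7531 ∨ 2.445 ≤ a ∧ a ≤ 2.4451 ∨ 3.8019 ≤ a ∧ a ≤ 3.802 := by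
  rcases lt_or_ge a 0.753 with h1 | h1
  · nlinarith [mul_nonneg (sub_nonneg.2 h1.le) h0, mul_nonneg (mul_nonneg (sub_nonneg.2 h1.le) h0) h0]
  rcases le_or_gt a 0.7531 with h2 | h2
  · exact Or.inl ⟨h1, h2⟩
  rcases lt_or_ge a 2.445 with h3 | h3
  · nlinarith [mul_nonneg (mul_nonneg (sub_nonneg.2 h2.le) (sub_nonneg.2 h3.le)) (sub_nonneg.2 h4),
      mul_nonneg (sub_nonneg.2 h2.le) (sub_nonneg.2 h3.le)]
  rcases le_or_gt a 2.4451 with h4' | h4'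
  · exact Or.inr (Or.inl ⟨h3, h4'⟩)
  rcases lt_or_ge a 3.8019 with h5 | h5
  · nlinarith [mul_nonneg (mul_nonneg (sub_nonneg.2 h4'.le) (sub_nonneg.2 h5.le)) h0,
      mul_nonneg (sub_nonneg.2 h4'.le) (sub_nonneg.2 h5.le)]
  rcases le_or_gt a 3.802 with h6 | h6
  · exact Or.inr (Or.inr ⟨h5, h6⟩)
  · nlinarith [mul_nonneg (sub_nonneg.2 h6.le) (sub_nonneg.2 h4), mul_nonneg (mul_nonneg (sub_nonneg.2 h6.le) h0) h0]

theorem abs_mul_le_of_le {x y m n c : ℝ} (hx : |x| ≤ m) (hy : |y| ≤ n) (h : m * n ≤ c) :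
    |x * y| ≤ c := by
  rw [abs_mul]
  exact (mul_le_mul hx hy (abs_nonneg _) ((abs_nonneg _).trans hx)).trans h

theorem abs_pow_le_of_le {x m : ℝ} (hx : |x| ≤ m) (n : ℕ) : |x ^ n| ≤ m ^ n := by
  rw [abs_pow]
  exact pow_le_pow_left₀ (abs_nonneg _) hx n

/-- `3 - b` is a unit, of absolute value about 1.618 and 0.618 at the two conjugates. Its cube
balances the suprema 0.094 and 1.69 of the cubic in `x`, bringing both just below 0.4. -/
theorem abs_cubic_mul_le {b x : ℝ} (hb : b ^ 2 - 5 * b + 5 = 0) (h0 : 0 ≤ x) (h1 : 4 * x ≤ 3 * b) :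
    |x * (x - 1) * (x - (b - 1)) * (3 - b) ^ 3| ≤ 0.4 := by
  have key : ∀ l r, l ≤ x → x ≤ r → ∀ i j, 0 ≤ (x - l) ^ i * (r - x) ^ j := fun l r hl hr i j =>
    sub_pow_mul_sub_pow_nonneg hl hr i j
  rcases quadratic_roots hb with ⟨h2, h3⟩ | ⟨h2, h3⟩
  · refine abs_mul_le_of_le (m := 0.094) ?_ (abs_pow_le_of_le (m := 1.6181) ?_ 3) (by norm_num)
    · rw [abs_le]
      have hx : x ≤ 1.0365 := by linarith
      constructor
      · rcases le_total x (25 / 32) with h | h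
        -- The polynomial in `x` has coefficients linear in `b`, so Bernstein products are
        -- multiplied by the distances from `b` to the two ends of its isolating interval.
        · have B1 := fun i j => mul_nonneg (sub_nonneg.2 h2) (key _ _ h0 h i j)
          have B2 := fun i j => mul_nonneg (sub_nonneg.2 h3) (key _ _ h0 h i j)
          linarith [B1 0 3, B1 1 2, B1 2 1, B1 3 0, B2 0 3, B2 1 2, B2 2 1, B2 3 0]
        · have B1 := fun i j => mul_nonneg (sub_nonneg.2 h2) (key _ _ h hx i j)
          have B2 := fun i j => mul_nonneg (sub_nonneg.2 h3) (key _ _ h hx i j)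
          linarith [B1 0 3, B1 1 2, B1 2 1, B1 3 0, B2 0 3, B2 1 2, B2 2 1, B2 3 0]
      · rcases le_total x (23 / 32) with h | h
        · have B1 := fun i j => mul_nonneg (sub_nonneg.2 h2) (key _ _ h0 h i j)
          have B2 := fun i j => mul_nonneg (sub_nonneg.2 h3) (key _ _ h0 h i j)
          linarith [B1 0 3, B1 1 2, B1 2 1, B1 3 0, B2 0 3, B2 1 2, B2 2 1, B2 3 0]
        · have B1 := fun i j => mul_nonneg (sub_nonneg.2 h2) (key _ _ h hx i j)
          have B2 := fun i j => mul_nonneg (sub_nonneg.2 h3) (key _ _ h hx i j)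
          linarith [B1 0 3, B1 1 2, B1 2 1, B1 3 0, B2 0 3, B2 1 2, B2 2 1, B2 3 0]
    · rw [abs_le]; constructor <;> linarith
  · refine abs_mul_le_of_le (m := 1.69) ?_ (abs_pow_le_of_le (m := 0.6181) ?_ 3) (by norm_num)
    · rw [abs_le]
      have hx : x ≤ 2.7137 := by linarith
      constructor
      · rcases le_total x (67 / 32) with h | h
        · have B1 := fun i j => mul_nonneg (sub_nonneg.2 h2) (key _ _ h0 h i j)
          have B2 := fun i j => mul_nonneg (sub_nonneg.2 h3) (key _ _ h0 h i j)
          linarith [B1 0 3, B1 1 2, B1 2 1, B1 3 0, B2 0 3, B2 1 2, B2 2 1, B2 3 0]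
        · have B1 := fun i j => mul_nonneg (sub_nonneg.2 h2) (key _ _ h hx i j)
          have B2 := fun i j => mul_nonneg (sub_nonneg.2 h3) (key _ _ h hx i j)
          linarith [B1 0 3, B1 1 2, B1 2 1, B1 3 0, B2 0 3, B2 1 2, B2 2 1, B2 3 0]
      · rcases le_total x (61 / 32) with h | h
        · have B1 := fun i j => mul_nonneg (sub_nonneg.2 h2) (key _ _ h0 h i j)
          have B2 := fun i j => mul_nonneg (sub_nonneg.2 h3) (key _ _ h0 h i j)
          linarith [B1 0 3, B1 1 2, B1 2 1, B1 3 0, B2 0 3, B2 1 2, B2 2 1, B2 3 0]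
        · have B1 := fun i j => mul_nonneg (sub_nonneg.2 h2) (key _ _ h hx i j)
          have B2 := fun i j => mul_nonneg (sub_nonneg.2 h3) (key _ _ h hx i j)
          linarith [B1 0 3, B1 1 2, B1 2 1, B1 3 0, B2 0 3, B2 1 2, B2 2 1, B2 3 0]
    · rw [abs_le]; constructor <;> linarith

theorem abs_quadratic_mul_le {b x : ℝ} (hb : b ^ 2 - 5 * b + 5 = 0) (h0 : 0 ≤ x)
    (h1 : 4 * x ≤ b * b) : |x * (x - (b - 1)) * (3 - b) ^ 4| ≤ 0.4 := by
  rcases quadratic_roots hb with ⟨h2, h3⟩ | ⟨h2, h3⟩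
  · have hx : x ≤ 0.4775 := by nlinarith
    refine abs_mul_le_of_le (m := 0.058) ?_ (abs_pow_le_of_le (m := 1.6181) ?_ 4) (by norm_num)
    · rw [abs_le]; constructor <;> nlinarith [sq_nonneg (2 * x - 0.382)]
    · rw [abs_le]; constructor <;> linarith
  · have hx : x ≤ 3.2727 := by nlinarith
    refine abs_mul_le_of_le (m := 2.7) ?_ (abs_pow_le_of_le (m := 0.6181) ?_ 4) (by norm_num)
    · rw [abs_le]; constructor <;> nlinarith [sq_nonneg (2 * x - 2.618)]
    · rw [abs_le]; constructor <;> linarith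

/-- Since `a (5 - a) = 5`, the second root is `v = a/5`, inside `[0, a/4]` for both conjugates; `3 -
a` is the balancing unit. -/
theorem abs_homogeneous_quadratic_le {a v : ℝ} (ha : a ^ 2 - 5 * a + 5 = 0) (h0 : 0 ≤ v)
    (h1 : 4 * v ≤ a) : |v * ((5 - a) * v - 1) * (3 - a)| ≤ 0.142 := by
  rcases quadratic_roots ha with ⟨h2, h3⟩ | ⟨h2, h3⟩
  · refine abs_mul_le_of_le (m := 0.0876) (n := 1.6181) ?_ ?_ (by norm_num)
    · rw [abs_le]; constructor <;> nlinarith [sq_nonneg (2 * 3.618 * v - 1)]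
    · rw [abs_le]; constructor <;> linarith
  · refine abs_mul_le_of_le (m := 0.2295) (n := 0.6181) ?_ ?_ (by norm_num)
    · rw [abs_le]; constructor <;> nlinarith [sq_nonneg (2 * 1.382 * v - 1)]
    · rw [abs_le]; constructor <;> linarith

theorem abs_septic_unit_mul_le {b x : ℝ} (hb0 : 0 ≤ b) (hb4 : b ≤ 4)
    (hb : b ^ 3 - 7 * b ^ 2 + 14 * b - 7 = 0) (h0 : 0 ≤ x) (h1 : 4 * x ≤ b * b) :
    |(x * (x - (b - 1)) * (b - 2)) ^ 2 * (4 - b) ^ 3| ≤ 0.3 := by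
  rcases cubic_roots hb0 hb4 hb with ⟨h2, h3⟩ | ⟨h2, h3⟩ | ⟨h2, h3⟩
  · have hx : x ≤ 0.1418 := by nlinarith
    refine abs_mul_le_of_le (abs_pow_le_of_le (abs_mul_le_of_le (m := 0.074) (n := 1.2471) ?_ ?_
      le_rfl) 2) (abs_pow_le_of_le (m := 3.2471) ?_ 3) (by norm_num)
    · rw [abs_le]; constructor <;> nlinarith
    · rw [abs_le]; constructor <;> linarith
    · rw [abs_le]; constructor <;> linarith
  · have hx : x ≤ 1.4947 := by nlinarith
    refine abs_mul_le_of_le (abs_pow_le_of_le (abs_mul_le_of_le (m := 0.63) (n := 0.4451) ?_ ?_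
      le_rfl) 2) (abs_pow_le_of_le (m := 1.5551) ?_ 3) (by norm_num)
    · rw [abs_le]; constructor <;> nlinarith [sq_nonneg (2 * x - 1.445)]
    · rw [abs_le]; constructor <;> linarith
    · rw [abs_le]; constructor <;> linarith
  · have hx : x ≤ 3.6139 := by nlinarith
    refine abs_mul_le_of_le (abs_pow_le_of_le (abs_mul_le_of_le (m := 3.4) (n := 1.8021) ?_ ?_
      le_rfl) 2) (abs_pow_le_of_le (m := 0.1982) ?_ 3) (by norm_num)
    · rw [abs_le]; constructor <;> nlinarith [sq_nonneg (2 * x - 2.802)]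
    · rw [abs_le]; constructor <;> linarith
    · rw [abs_le]; constructor <;> linarith

/-- The cubic takes the value 1 at 2 and at 4, so `a - 2` and `4 - a` are units; they balance the
suprema of the quartic at the three conjugates. -/
theorem abs_homogeneous_quartic_le {a v : ℝ} (ha0 : 0 ≤ a) (ha4 : a ≤ 4)
    (ha : a ^ 3 - 7 * a ^ 2 + 14 * a - 7 = 0) (h0 : 0 ≤ v) (h1 : 4 * v ≤ a) :
    |v ^ 2 * (v - 1) * ((10 - 6 * a + a ^ 2) * v - 1) * ((a - 2) ^ 2 * (4 - a))| ≤ 0.0325 := by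
  have key : ∀ l r, l ≤ v → v ≤ r → ∀ i j, 0 ≤ (v - l) ^ i * (r - v) ^ j := fun l r hl hr i j =>
    sub_pow_mul_sub_pow_nonneg hl hr i j
  set g := 10 - 6 * a + a ^ 2 with hg
  rcases cubic_roots ha0 ha4 ha with ⟨h2, h3⟩ | ⟨h2, h3⟩ | ⟨h2, h3⟩
  · have hg1 : 6.0485 ≤ g := by nlinarith
    have hg2 : g ≤ 6.0491 := by nlinarith
    refine abs_mul_le_of_le (m := 0.0064) ?_ (abs_mul_le_of_le (abs_pow_le_of_le (m := 1.2471) ?_ 2)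
      (n := 3.2471) ?_ le_rfl) (by norm_num)
    · rw [abs_le]
      have B := key 0 0.1883 h0 (by linarith)
      have B1 := fun i j => mul_nonneg (sub_nonneg.2 hg1) (B i j)
      have B2 := fun i j => mul_nonneg (sub_nonneg.2 hg2) (B i j)
      constructor <;> linarith [B1 0 4, B1 1 3, B1 2 2, B1 3 1, B1 4 0, B2 0 4, B2 1 3, B2 2 2,
        B2 3 1, B2 4 0]
    · rw [abs_le]; constructor <;> linarith
    · rw [abs_le]; constructor <;> linarith
  · have hg1 : 1.3079 ≤ g := by nlinarith
    have hg2 : g ≤ 1.3081 := by nlinarith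
    refine abs_mul_le_of_le (m := 0.105) ?_ (abs_mul_le_of_le (abs_pow_le_of_le (m := 0.4451) ?_ 2)
      (n := 1.5551) ?_ le_rfl) (by norm_num)
    · rw [abs_le]
      have B := key 0 0.6113 h0 (by linarith)
      have B1 := fun i j => mul_nonneg (sub_nonneg.2 hg1) (B i j)
      have B2 := fun i j => mul_nonneg (sub_nonneg.2 hg2) (B i j)
      constructor <;> linarith [B1 0 4, B1 1 3, B1 2 2, B1 3 1, B1 4 0, B2 0 4, B2 1 3, B2 2 2,
        B2 3 1, B2 4 0]
    · rw [abs_le]; constructor <;> linarith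
    · rw [abs_le]; constructor <;> linarith
  · have hg1 : 1.6430 ≤ g := by nlinarith
    have hg2 : g ≤ 1.6433 := by nlinarith
    refine abs_mul_le_of_le (m := 0.05) ?_ (abs_mul_le_of_le (abs_pow_le_of_le (m := 1.802) ?_ 2)
      (n := 0.1981) ?_ le_rfl) (by norm_num)
    · rw [abs_le]
      have hx : v ≤ 0.9505 := by linarith
      constructor
      · rcases le_total v (27 / 32) with h | h
        · have B1 := fun i j => mul_nonneg (sub_nonneg.2 hg1) (key _ _ h0 h i j)
          have B2 := fun i j => mul_nonneg (sub_nonneg.2 hg2) (key _ _ h0 h i j)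
          linarith [B1 0 4, B1 1 3, B1 2 2, B1 3 1, B1 4 0, B2 0 4, B2 1 3, B2 2 2, B2 3 1,
            B2 4 0]
        · have B1 := fun i j => mul_nonneg (sub_nonneg.2 hg1) (key _ _ h hx i j)
          have B2 := fun i j => mul_nonneg (sub_nonneg.2 hg2) (key _ _ h hx i j)
          linarith [B1 0 4, B1 1 3, B1 2 2, B1 3 1, B1 4 0, B2 0 4, B2 1 3, B2 2 2, B2 3 1,
            B2 4 0]
      · rcases le_total v (17 / 32) with h | h
        · have B1 := fun i j => mul_nonneg (sub_nonneg.2 hg1) (key _ _ h0 h i j)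
          have B2 := fun i j => mul_nonneg (sub_nonneg.2 hg2) (key _ _ h0 h i j)
          linarith [B1 0 4, B1 1 3, B1 2 2, B1 3 1, B1 4 0, B2 0 4, B2 1 3, B2 2 2, B2 3 1,
            B2 4 0]
        · have B1 := fun i j => mul_nonneg (sub_nonneg.2 hg1) (key _ _ h hx i j)
          have B2 := fun i j => mul_nonneg (sub_nonneg.2 hg2) (key _ _ h hx i j)
          linarith [B1 0 4, B1 1 3, B1 2 2, B1 3 1, B1 4 0, B2 0 4, B2 1 3, B2 2 2, B2 3 1,
            B2 4 0]
    · rw [abs_le]; constructor <;> linarith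
    · rw [abs_le]; constructor <;> linarith

end PolynomialBounds

/-! ### The auxiliary polynomial for the orders 3 and 7 -/

section SepticBound

/-- On a short interval `[p, q]` it is enough to bound each factor separately, using its values at
the ends. -/
theorem abs_nonic_prod_le {x p q c₀ c₁ c₂ c₃ M : ℝ}
    (m0 m1 m2 m3 m4 m5 : ℝ) (hp : p ≤ x) (hq : x ≤ q)
    (h0 : -m0 ≤ p ∧ q ≤ m0) (h1 : -m1 ≤ p - 1 ∧ q - 1 ≤ m1)
    (h2 : q - m2 ≤ c₀ ∧ c₀ ≤ p + m2) (h3 : q - m3 ≤ c₁ ∧ c₁ ≤ p + m3)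
    (h4 : q - m4 ≤ c₂ ∧ c₂ ≤ p + m4) (h5 : q - m5 ≤ c₃ ∧ c₃ ≤ p + m5)
    (h : m0 ^ 2 * m1 ^ 2 * m2 ^ 2 * m3 * m4 * m5 ≤ M) :
    |x ^ 2 * (x - 1) ^ 2 * (x - c₀) ^ 2 * (x - c₁) * (x - c₂) * (x - c₃)| ≤ M := by
  have k0 : |x| ≤ m0 := abs_le.2 ⟨by linarith, by linarith⟩
  have k1 : |x - 1| ≤ m1 := abs_le.2 ⟨by linarith, by linarith⟩
  have k2 : |x - c₀| ≤ m2 := abs_le.2 ⟨by linarith, by linarith⟩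
  have k3 : |x - c₁| ≤ m3 := abs_le.2 ⟨by linarith, by linarith⟩
  have k4 : |x - c₂| ≤ m4 := abs_le.2 ⟨by linarith, by linarith⟩
  have k5 : |x - c₃| ≤ m5 := abs_le.2 ⟨by linarith, by linarith⟩
  have l3 := (abs_nonneg _).trans k3
  have l4 := (abs_nonneg _).trans k4
  refine le_trans ?_ h
  simp only [abs_mul, abs_pow]
  gcongr

-- The roots are 0, 1 and four elements of `ℤ[b]`, and the units `b - 2` and `4 - b` weigh the three
-- conjugates so that each supremum stays below 0.094. At each conjugate, `[0, 3b/4]` is cut into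
-- short intervals.
set_option maxHeartbeats 2000000 in
theorem abs_septic_nonic_mul_le {b x : ℝ} (hb0 : 0 ≤ b) (hb4 : b ≤ 4)
    (hb : b ^ 3 - 7 * b ^ 2 + 14 * b - 7 = 0) (h0 : 0 ≤ x) (h1 : 4 * x ≤ 3 * b) :
    |x ^ 2 * (x - 1) ^ 2 * (x - (b - 1)) ^ 2 * (x - (3 - 4 * b + b ^ 2)) *
      (x - (-2 + 4 * b - b ^ 2)) * (x - (2 - 3 * b + b ^ 2)) * ((b - 2) ^ 3 * (4 - b) ^ 5)| ≤
      0.094 := by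
  rcases cubic_roots hb0 hb4 hb with ⟨h2, h3⟩ | ⟨h2, h3⟩ | ⟨h2, h3⟩
  · have hx : x ≤ 0.5649 := by linarith
    -- The bound left for the polynomial is 0.094 divided by the size of the unit at this conjugate.
    refine abs_mul_le_of_le (m := 0.094 / (1.247 ^ 3 * 3.247 ^ 5)) ?_ (abs_mul_le_of_le
      (abs_pow_le_of_le (m := 1.247) ?_ 3) (abs_pow_le_of_le (m := 3.247) ?_ 5) le_rfl) (by norm_num)
    · have k0 : -0.2471 ≤ b - 1 := by nlinarith
      have l0 : b - 1 ≤ -0.2468 := by nlinarith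
      have k1 : 0.5546 ≤ 3 - 4 * b + b ^ 2 := by nlinarith
      have l1 : 3 - 4 * b + b ^ 2 ≤ 0.5552 := by nlinarith
      have k2 : 0.4448 ≤ -2 + 4 * b - b ^ 2 := by nlinarith
      have l2 : -2 + 4 * b - b ^ 2 ≤ 0.4454 := by nlinarith
      have k3 : 0.3077 ≤ 2 - 3 * b + b ^ 2 := by nlinarith
      have l3 : 2 - 3 * b + b ^ 2 ≤ 0.3082 := by nlinarith
      rcases le_total x 0.115 with h | h'
      · exact abs_nonic_prod_le 0.115 1 0.3621 0.5552 0.4454 0.3082 h0 h (by norm_num) (by norm_num)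
          ⟨by linarith, by linarith⟩ ⟨by linarith, by linarith⟩ ⟨by linarith, by linarith⟩
          ⟨by linarith, by linarith⟩ (by norm_num)
      rcases le_total x 0.182 with h | h'
      · exact abs_nonic_prod_le 0.182 0.885 0.4291 0.4402 0.3304 0.1932 h' h (by norm_num) (by norm_num)
          ⟨by linarith, by linarith⟩ ⟨by linarith, by linarith⟩ ⟨by linarith, by linarith⟩
          ⟨by linarith, by linarith⟩ (by norm_num)
      rcases le_total x 0.253 with h | h'
      · exact abs_nonic_prod_le 0.253 0.818 0.5001 0.3732 0.2634 0.1262 h' h (by norm_num) (by norm_num)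
          ⟨by linarith, by linarith⟩ ⟨by linarith, by linarith⟩ ⟨by linarith, by linarith⟩
          ⟨by linarith, by linarith⟩ (by norm_num)
      rcases le_total x 0.38 with h | h'
      · exact abs_nonic_prod_le 0.38 0.747 0.6271 0.3022 0.1924 0.0723 h' h (by norm_num) (by norm_num)
          ⟨by linarith, by linarith⟩ ⟨by linarith, by linarith⟩ ⟨by linarith, by linarith⟩
          ⟨by linarith, by linarith⟩ (by norm_num)
      rcases le_total x 0.51 with h | h'
      · exact abs_nonic_prod_le 0.51 0.62 0.7571 0.1752 0.0654 0.2023 h' h (by norm_num) (by norm_num)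
          ⟨by linarith, by linarith⟩ ⟨by linarith, by linarith⟩ ⟨by linarith, by linarith⟩
          ⟨by linarith, by linarith⟩ (by norm_num)
      exact abs_nonic_prod_le 0.5649 0.49 0.812 0.0452 0.1201 0.2572 h' hx (by norm_num) (by norm_num)
        ⟨by linarith, by linarith⟩ ⟨by linarith, by linarith⟩ ⟨by linarith, by linarith⟩
        ⟨by linarith, by linarith⟩ (by norm_num)
    · rw [abs_le]; constructor <;> linarith
    · rw [abs_le]; constructor <;> linarith
  · have hx : x ≤ 1.8339 := by linarith
    refine abs_mul_le_of_le (m := 0.094 / (0.4451 ^ 3 * 1.555 ^ 5)) ?_ (abs_mul_le_of_le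
      (abs_pow_le_of_le (m := 0.4451) ?_ 3) (abs_pow_le_of_le (m := 1.555) ?_ 5) le_rfl) (by norm_num)
    · have k0 : 1.4449 ≤ b - 1 := by nlinarith
      have l0 : b - 1 ≤ 1.4452 := by nlinarith
      have k1 : -0.8021 ≤ 3 - 4 * b + b ^ 2 := by nlinarith
      have l1 : 3 - 4 * b + b ^ 2 ≤ -0.8017 := by nlinarith
      have k2 : 1.8017 ≤ -2 + 4 * b - b ^ 2 := by nlinarith
      have l2 : -2 + 4 * b - b ^ 2 ≤ 1.8021 := by nlinarith
      have k3 : 0.6429 ≤ 2 - 3 * b + b ^ 2 := by nlinarith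
      have l3 : 2 - 3 * b + b ^ 2 ≤ 0.6434 := by nlinarith
      rcases le_total x 0.217 with h | h'
      · exact abs_nonic_prod_le 0.217 1 1.4452 1.0191 1.8021 0.6434 h0 h (by norm_num) (by norm_num)
          ⟨by linarith, by linarith⟩ ⟨by linarith, by linarith⟩ ⟨by linarith, by linarith⟩
          ⟨by linarith, by linarith⟩ (by norm_num)
      rcases le_total x 0.395 with h | h'
      · exact abs_nonic_prod_le 0.395 0.783 1.2282 1.1971 1.5851 0.4264 h' h (by norm_num) (by norm_num)
          ⟨by linarith, by linarith⟩ ⟨by linarith, by linarith⟩ ⟨by linarith, by linarith⟩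
          ⟨by linarith, by linarith⟩ (by norm_num)
      rcases le_total x 0.735 with h | h'
      · exact abs_nonic_prod_le 0.735 0.605 1.0502 1.5371 1.4071 0.2484 h' h (by norm_num) (by norm_num)
          ⟨by linarith, by linarith⟩ ⟨by linarith, by linarith⟩ ⟨by linarith, by linarith⟩
          ⟨by linarith, by linarith⟩ (by norm_num)
      rcases le_total x 1.303 with h | h'
      · exact abs_nonic_prod_le 1.303 0.303 0.7102 2.1051 1.0671 0.6601 h' h (by norm_num) (by norm_num)
          ⟨by linarith, by linarith⟩ ⟨by linarith, by linarith⟩ ⟨by linarith, by linarith⟩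
          ⟨by linarith, by linarith⟩ (by norm_num)
      rcases le_total x 1.697 with h | h'
      · exact abs_nonic_prod_le 1.697 0.697 0.2521 2.4991 0.4991 1.0541 h' h (by norm_num) (by norm_num)
          ⟨by linarith, by linarith⟩ ⟨by linarith, by linarith⟩ ⟨by linarith, by linarith⟩
          ⟨by linarith, by linarith⟩ (by norm_num)
      exact abs_nonic_prod_le 1.8339 0.8339 0.389 2.636 0.1051 1.191 h' hx (by norm_num) (by norm_num)
        ⟨by linarith, by linarith⟩ ⟨by linarith, by linarith⟩ ⟨by linarith, by linarith⟩
        ⟨by linarith, by linarith⟩ (by norm_num)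
    · rw [abs_le]; constructor <;> linarith
    · rw [abs_le]; constructor <;> linarith
  · have hx : x ≤ 2.8515 := by linarith
    refine abs_mul_le_of_le (m := 0.094 / (1.802 ^ 3 * 0.1981 ^ 5)) ?_ (abs_mul_le_of_le
      (abs_pow_le_of_le (m := 1.802) ?_ 3) (abs_pow_le_of_le (m := 0.1981) ?_ 5) le_rfl) (by norm_num)
    · have k0 : 2.8018 ≤ b - 1 := by nlinarith
      have l0 : b - 1 ≤ 2.8021 := by nlinarith
      have k1 : 2.2467 ≤ 3 - 4 * b + b ^ 2 := by nlinarith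
      have l1 : 3 - 4 * b + b ^ 2 ≤ 2.2474 := by nlinarith
      have k2 : -1.2474 ≤ -2 + 4 * b - b ^ 2 := by nlinarith
      have l2 : -2 + 4 * b - b ^ 2 ≤ -1.2467 := by nlinarith
      have k3 : 5.0486 ≤ 2 - 3 * b + b ^ 2 := by nlinarith
      have l3 : 2 - 3 * b + b ^ 2 ≤ 5.0494 := by nlinarith
      rcases le_total x 0.57 with h | h'
      · exact abs_nonic_prod_le 0.57 1 2.8021 2.2474 1.8174 5.0494 h0 h (by norm_num) (by norm_num)
          ⟨by linarith, by linarith⟩ ⟨by linarith, by linarith⟩ ⟨by linarith, by linarith⟩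
          ⟨by linarith, by linarith⟩ (by norm_num)
      rcases le_total x 1.483 with h | h'
      · exact abs_nonic_prod_le 1.483 0.483 2.2321 1.6774 2.7304 4.4794 h' h (by norm_num) (by norm_num)
          ⟨by linarith, by linarith⟩ ⟨by linarith, by linarith⟩ ⟨by linarith, by linarith⟩
          ⟨by linarith, by linarith⟩ (by norm_num)
      rcases le_total x 1.953 with h | h'
      · exact abs_nonic_prod_le 1.953 0.953 1.3191 0.7644 3.2004 3.5664 h' h (by norm_num) (by norm_num)
          ⟨by linarith, by linarith⟩ ⟨by linarith, by linarith⟩ ⟨by linarith, by linarith⟩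
          ⟨by linarith, by linarith⟩ (by norm_num)
      rcases le_total x 2.6 with h | h'
      · exact abs_nonic_prod_le 2.6 1.6 0.8491 0.3533 3.8474 3.0964 h' h (by norm_num) (by norm_num)
          ⟨by linarith, by linarith⟩ ⟨by linarith, by linarith⟩ ⟨by linarith, by linarith⟩
          ⟨by linarith, by linarith⟩ (by norm_num)
      exact abs_nonic_prod_le 2.8515 1.8515 0.2021 0.6048 4.0989 2.4494 h' hx (by norm_num) (by norm_num)
        ⟨by linarith, by linarith⟩ ⟨by linarith, by linarith⟩ ⟨by linarith, by linarith⟩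
        ⟨by linarith, by linarith⟩ (by norm_num)
    · rw [abs_le]; constructor <;> linarith
    · rw [abs_le]; constructor <;> linarith

end SepticBound

/-! ### The auxiliary polynomial for the orders 4 and 7 -/

section SepticBound

theorem abs_sextic_mul_le {b x : ℝ} (hb0 : 0 ≤ b) (hb4 : b ≤ 4)
    (hb : b ^ 3 - 7 * b ^ 2 + 14 * b - 7 = 0) (h0 : 0 ≤ x) (h1 : 4 * x ≤ 2 * b) :
    |(x * (x - 1)) ^ 3 * ((4 - b) ^ 3 * (b - 1))| ≤ 0.12 := by
  rcases cubic_roots hb0 hb4 hb with ⟨h2, h3⟩ | ⟨h2, h3⟩ | ⟨h2, h3⟩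
  · have hx : x ≤ 0.37655 := by linarith
    refine abs_mul_le_of_le (abs_pow_le_of_le (m := 0.235) ?_ 3) (abs_mul_le_of_le
      (abs_pow_le_of_le (m := 3.2471) ?_ 3) (n := 0.2471) ?_ le_rfl) (by norm_num)
    · rw [abs_le]; constructor <;> nlinarith
    · rw [abs_le]; constructor <;> linarith
    · rw [abs_le]; constructor <;> linarith
  · have hx : x ≤ 1.22255 := by linarith
    refine abs_mul_le_of_le (abs_pow_le_of_le (m := 0.2722) ?_ 3) (abs_mul_le_of_le
      (abs_pow_le_of_le (m := 1.5551) ?_ 3) (n := 1.4452) ?_ le_rfl) (by norm_num)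
    · rw [abs_le]; constructor <;> nlinarith [sq_nonneg (2 * x - 1)]
    · rw [abs_le]; constructor <;> linarith
    · rw [abs_le]; constructor <;> linarith
  · have hx : x ≤ 1.901 := by linarith
    refine abs_mul_le_of_le (abs_pow_le_of_le (m := 1.713) ?_ 3) (abs_mul_le_of_le
      (abs_pow_le_of_le (m := 0.1982) ?_ 3) (n := 2.8021) ?_ le_rfl) (by norm_num)
    · rw [abs_le]; constructor <;> nlinarith [sq_nonneg (2 * x - 1)]
    · rw [abs_le]; constructor <;> linarith
    · rw [abs_le]; constructor <;> linarith

end SepticBound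

/-! ### Equations and isolating intervals for the orders 3, 4, 5, 7 -/

section SmallOrders

variable {K : Type*} [Field K] {ι : K →+* ℝ} {a : K}

theorem eq_three_of_apply_eq (ha : ι a = 4 - (2 * Real.cos (Real.pi / (3 : ℕ))) ^ 2) : a = 3 := by
  apply ι.injective
  rw [ha, Nat.cast_ofNat, Real.cos_pi_div_three, map_ofNat]
  norm_num

theorem eq_two_of_apply_eq (ha : ι a = 4 - (2 * Real.cos (Real.pi / (4 : ℕ))) ^ 2) : a = 2 := by
  apply ι.injective
  rw [ha, Nat.cast_ofNat, Real.cos_pi_div_four, map_ofNat]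
  have : √2 ^ 2 = 2 := Real.sq_sqrt (by norm_num)
  linarith

theorem quadratic_of_apply_eq (ha : ι a = 4 - (2 * Real.cos (Real.pi / (5 : ℕ))) ^ 2) :
    a ^ 2 - 5 * a + 5 = 0 ∧ 1.3819 ≤ ι a ∧ ι a ≤ 1.382 := by
  have h5 : √5 ^ 2 = 5 := Real.sq_sqrt (by norm_num)
  rw [Nat.cast_ofNat, Real.cos_pi_div_five] at ha
  have h1 : ι a ^ 2 - 5 * ι a + 5 = 0 := by
    rw [ha]
    linear_combination (1 / 16 * √5 ^ 2 + 1 / 4 * √5 - 1 / 16) * h5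
  refine ⟨ι.injective (by simpa [map_ofNat] using h1), ?_⟩
  rcases quadratic_roots h1 with h | h
  · exact h
  · nlinarith [Real.sqrt_nonneg 5]

theorem cubic_of_apply_eq (ha : ι a = 4 - (2 * Real.cos (Real.pi / (7 : ℕ))) ^ 2) :
    a ^ 3 - 7 * a ^ 2 + 14 * a - 7 = 0 ∧ 0.753 ≤ ι a ∧ ι a ≤ 0.7531 := by
  rw [Nat.cast_ofNat] at ha
  set y := Real.pi / 7 with hy
  have hy0 : 0 < y := by positivity
  -- `4y = π - 3y` for `y = π/7`; written in `cos y`, this equation has the spurious factor `cos y +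
  -- 1`.
  have h4 : Real.cos (2 * (2 * y)) = -Real.cos (3 * y) := by
    rw [← Real.cos_pi_sub]
    congr 1
    rw [hy]; ring
  rw [Real.cos_three_mul, Real.cos_two_mul, Real.cos_two_mul] at h4
  have hc : 0 < Real.cos y := Real.cos_pos_of_mem_Ioo ⟨by linarith, by rw [hy]; linarith [Real.pi_pos]⟩
  have h5 : 8 * Real.cos y ^ 3 - 4 * Real.cos y ^ 2 - 4 * Real.cos y + 1 = 0 := by
    have : (Real.cos y + 1) * (8 * Real.cos y ^ 3 - 4 * Real.cos y ^ 2 - 4 * Real.cos y + 1) = 0 := by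
      linear_combination h4
    exact (mul_eq_zero.1 this).resolve_left (by linarith)
  have h1 : ι a ^ 3 - 7 * ι a ^ 2 + 14 * ι a - 7 = 0 := by
    rw [ha]
    -- The cubic at `4 - 4c²` is `f(c) f(-c)`, where `f(c) = 8c³ - 4c² - 4c + 1` vanishes at `c =
    -- cos y`.
    linear_combination (-(8 * Real.cos y ^ 3 + 4 * Real.cos y ^ 2 - 4 * Real.cos y - 1)) * h5
  have hs : Real.sin y < y := Real.sin_lt hy0
  have hs0 : 0 < Real.sin y := Real.sin_pos_of_pos_of_lt_pi hy0 (by rw [hy]; linarith [Real.pi_pos])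
  have hy1 : y ≤ 0.45 := by rw [hy]; linarith [Real.pi_lt_d2]
  have ha' : ι a = 4 * Real.sin y ^ 2 := by rw [ha]; linarith [Real.sin_sq_add_cos_sq y]
  have ha0 : 0 ≤ ι a := by rw [ha']; positivity
  have ha1 : ι a ≤ 0.81 := by rw [ha']; nlinarith
  refine ⟨ι.injective (by simpa [map_ofNat] using h1), ?_⟩
  rcases cubic_roots ha0 (by linarith) h1 with h | h | h
  · exact h
  · linarith
  · linarith

end SmallOrders

/-! ### The degree bound from a small algebraic integer -/

section DegreeBound

open Module NumberField

theorem abs_mul_bounds {x y m n : ℝ} (hx : 0 < |x| ∧ |x| ≤ m) (hy : 0 < |y| ∧ |y| ≤ n) :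
    0 < |x * y| ∧ |x * y| ≤ m * n :=
  ⟨by rw [abs_mul]; exact mul_pos hx.1 hy.1, abs_mul_le_of_le hx.2 hy.2 le_rfl⟩

theorem abs_pow_bounds {x m : ℝ} (hx : 0 < |x| ∧ |x| ≤ m) (n : ℕ) :
    0 < |x ^ n| ∧ |x ^ n| ≤ m ^ n :=
  ⟨by rw [abs_pow]; exact pow_pos hx.1 n, abs_pow_le_of_le hx.2 n⟩

theorem abs_bounds_of_pos {x m : ℝ} (h0 : 0 < x) (h1 : x ≤ m) : 0 < |x| ∧ |x| ≤ m := by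
  rw [abs_of_pos h0]; exact ⟨h0, h1⟩

theorem abs_bounds_of_neg {x m : ℝ} (h0 : x < 0) (h1 : -m ≤ x) : 0 < |x| ∧ |x| ≤ m := by
  rw [abs_of_neg h0]; exact ⟨by linarith, by linarith⟩

variable {K : Type*} [Field K] [NumberField K] [IsTotallyReal K]

/-- Raising the degree by one multiplies the upper bound for `|N(z)|` by `C B^D ≤ 1`, so a
contradiction in degree `n + 1` persists in all higher degrees. -/
theorem finrank_le_of_abs_le_mul (ι : K →+* ℝ) {z w : K} (hz : IsIntegral ℤ z) {Z A B C : ℝ}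
    {n D : ℕ} (hZ : 0 < |ι z| ∧ |ι z| ≤ Z) (h : ∀ τ : K →+* ℝ, τ ≠ ι → |τ z| ≤ C * |τ w|)
    (hw : 0 < ι w)
    (hnorm : n < finrank ℚ K →
      |((Algebra.norm ℚ w : ℚ) : ℝ)| ≤ (A * B ^ finrank ℚ K) ^ D * ι w)
    (hA : 0 ≤ A) (hB : 0 ≤ B) (hC : 0 ≤ C) (hCB : C * B ^ D ≤ 1)
    (hlt : Z * C ^ n * (A * B ^ (n + 1)) ^ D < 1) : finrank ℚ K ≤ n := by
  by_contra! hn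
  have hz0 : z ≠ 0 := by rintro rfl; simp at hZ
  have h1 := abs_le_mul_pow_mul_abs_norm ι hz hz0 h
  have h2 := hnorm hn
  obtain ⟨m, hm⟩ := Nat.exists_eq_add_of_lt hn
  rw [abs_of_pos hw] at h1
  rw [hm] at h1 h2
  simp only [Nat.add_sub_cancel] at h1
  have hZ0 : 0 ≤ Z := (abs_nonneg _).trans hZ.2
  have h3 : ι w ≤ (Z * C ^ n * (A * B ^ (n + 1)) ^ D) * ι w := by
    calc ι w ≤ |ι z| * C ^ (n + m) * |((Algebra.norm ℚ w : ℚ) : ℝ)| := h1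
      _ ≤ Z * C ^ (n + m) * ((A * B ^ (n + m + 1)) ^ D * ι w) := by
        have := hZ.2
        gcongr
      _ = (Z * C ^ n * (A * B ^ (n + 1)) ^ D) * ι w * (C * B ^ D) ^ m := by ring
      _ ≤ (Z * C ^ n * (A * B ^ (n + 1)) ^ D) * ι w * 1 := by
        gcongr
        exact pow_le_one₀ (by positivity) hCB
      _ = _ := mul_one _
  nlinarith

theorem finrank_le_of_abs_le (ι : K →+* ℝ) {z : K} (hz : IsIntegral ℤ z) {Z C : ℝ} {n : ℕ}
    (hZ : 0 < |ι z| ∧ |ι z| ≤ Z) (h : ∀ τ : K →+* ℝ, τ ≠ ι → |τ z| ≤ C) (hC : 0 ≤ C)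
    (hC1 : C ≤ 1) (hlt : Z * C ^ n < 1) : finrank ℚ K ≤ n :=
  -- With `w = 1` and `D = 0` the norm factor is a zeroth power, hence 1, whatever `A` and `B` are.
  finrank_le_of_abs_le_mul ι (w := 1) (A := 0) (B := 0) (D := 0) hz hZ (by simpa using h)
    (by simp) (by simp) le_rfl le_rfl hC (by simpa using hC1) (by simpa using hlt)

end DegreeBound

/-! ### Degree bounds for each pair of orders -/

section EdgeFieldDegree

open Module NumberField

theorem isIntegral_int_ofNat {K : Type*} [Field K] (n : ℕ) [n.AtLeastTwo] :
    IsIntegral ℤ (ofNat(n) : K) := by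
  rw [← Nat.cast_ofNat]
  exact isIntegral_natCast (R := ℤ) (B := K) n

namespace IsEdgeField

variable {K : Type*} [Field K] {ι : K →+* ℝ} {s k : ℕ} {t a b : K}

theorem apply_b_pos (h : IsEdgeField ι s k t a b) : 0 < ι b := by
  rw [h.apply_b]
  linarith [two_mul_cos_sq_lt_four h.three_le_k]

theorem apply_b_le (h : IsEdgeField ι s k t a b) : ι b ≤ 4 := by
  rw [h.apply_b]
  linarith [sq_nonneg (2 * Real.cos (Real.pi / k))]

theorem b_pos (h : IsEdgeField ι s k t a b) {τ : K →+* ℝ} (hτ : τ ≠ ι) : 0 < τ b := by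
  refine (h.nonneg_b τ hτ).lt_of_ne' ((map_ne_zero τ).2 ?_)
  rintro rfl
  simpa using h.apply_b_pos

/-- For `s = 4` one has `a = 2`, so the bound of the case `s = 3` holds a fortiori and the two
orders can share auxiliary polynomials. -/
theorem four_mul_le_three_mul (h : IsEdgeField ι s k t a b) (hs : s = 3 ∨ s = 4) {τ : K →+* ℝ}
    (hτ : τ ≠ ι) : 4 * τ t ≤ 3 * τ b := by
  refine (h.t_le τ hτ).trans (mul_le_mul_of_nonneg_right ?_ (h.nonneg_b τ hτ))
  rcases hs with rfl | rfl
  · rw [eq_three_of_apply_eq h.apply_a, map_ofNat]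
  · rw [eq_two_of_apply_eq h.apply_a, map_ofNat]
    norm_num

theorem apply_t_bounds (h : IsEdgeField ι s k t a b) : 0 < |ι t| ∧ |ι t| ≤ 196 :=
  abs_bounds_of_pos (by linarith [h.four_lt]) h.lt_max.le

/-- A bound for a form of degree `D` in `t` and `b` in terms of the quotient `t / b`. -/
theorem exists_eq_mul (h : IsEdgeField ι s k t a b) {τ : K →+* ℝ} (hτ : τ ≠ ι) :
    ∃ v, τ t = v * τ b ∧ 0 ≤ v ∧ 4 * v ≤ τ a := by
  have hb := h.b_pos hτ
  refine ⟨τ t / τ b, (div_mul_cancel₀ _ hb.ne').symm, div_nonneg (h.nonneg_t τ hτ) hb.le, ?_⟩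
  rw [← mul_div_assoc, div_le_iff₀ hb]
  exact h.t_le τ hτ

theorem quadratic_b (h : IsEdgeField ι s 5 t a b) (τ : K →+* ℝ) : τ b ^ 2 - 5 * τ b + 5 = 0 := by
  simpa [map_ofNat] using congrArg τ (quadratic_of_apply_eq h.apply_b).1

theorem cubic_b (h : IsEdgeField ι s 7 t a b) (τ : K →+* ℝ) :
    τ b ^ 3 - 7 * τ b ^ 2 + 14 * τ b - 7 = 0 := by
  simpa [map_ofNat] using congrArg τ (cubic_of_apply_eq h.apply_b).1

variable [NumberField K]

theorem norm_b_le (h : IsEdgeField ι s k t a b) (hk : 8 ≤ k ∨ k = 6) {D : ℕ}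
    (hN : 20 < finrank ℚ K) :
    |((Algebra.norm ℚ (b ^ D) : ℚ) : ℝ)| ≤ (0.45 * 1.75 ^ finrank ℚ K) ^ D * ι (b ^ D) := by
  rw [map_pow, map_pow, Rat.cast_pow, abs_pow, ← mul_pow]
  exact pow_le_pow_left₀ (abs_nonneg _) (abs_norm_le_mul_apply hk h.apply_b hN) D

theorem two_dvd_finrank (h : IsEdgeField ι s 5 t a b) : 2 ∣ finrank ℚ K := by
  have := totient_dvd_two_mul_finrank ι (by norm_num) h.apply_b
  rw [show Nat.totient 5 = 4 by decide] at this
  lia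

theorem three_dvd_finrank (h : IsEdgeField ι s 7 t a b) : 3 ∣ finrank ℚ K := by
  have := totient_dvd_two_mul_finrank ι (by norm_num) h.apply_b
  rw [show Nat.totient 7 = 6 by decide] at this
  lia

variable [IsTotallyReal K]

theorem finrank_le_of_eight_le (h : IsEdgeField ι s k t a b) (hs : 8 ≤ s ∨ s = 6)
    (hk : 8 ≤ k ∨ k = 6) : finrank ℚ K ≤ 20 := by
  refine finrank_le_of_abs_le_mul ι (w := a * b) (A := 0.45) (B := 1.75) (C := 1 / 4) (D := 2)
    h.isIntegral_t h.apply_t_bounds (fun τ hτ => ?_) ?_ (fun hN => ?_) (by norm_num) (by norm_num)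
    (by norm_num) (by norm_num) (by norm_num)
  · have h1 := h.t_le τ hτ
    rw [abs_of_nonneg (h.nonneg_t τ hτ), map_mul,
      abs_of_nonneg (mul_nonneg (h.nonneg_a τ hτ) (h.nonneg_b τ hτ))]
    linarith
  · rw [map_mul]
    exact mul_pos h.symm.apply_b_pos h.apply_b_pos
  · have h1 := h.symm.norm_b_le (D := 1) hs hN
    have h2 := h.norm_b_le (D := 1) hk hN
    rw [pow_one, pow_one] at h1 h2
    rw [map_mul, map_mul, Rat.cast_mul, abs_mul]
    calc _ ≤ _ := mul_le_mul h1 h2 (abs_nonneg _) ((abs_nonneg _).trans h1)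
      _ = _ := by ring

theorem finrank_le_of_three_three (h : IsEdgeField ι 3 3 t a b) : finrank ℚ K ≤ 25 := by
  refine finrank_le_of_abs_le ι (z := t * (t - 1) * (t - 2) ^ 2 * (t ^ 2 - 3 * t + 1)) (C := 0.27)
    (Z := 196 * 195 * 194 ^ 2 * (196 ^ 2 - 587)) ?_ ?_ (fun τ hτ => ?_)
    (by norm_num) (by norm_num) (by norm_num)
  · simp (maxDischargeDepth := 12) only [IsIntegral.mul, IsIntegral.add, IsIntegral.sub, IsIntegral.pow, isIntegral_one,
      isIntegral_int_ofNat, h.isIntegral_t]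
  · simp only [map_mul, map_sub, map_add, map_pow, map_one, map_ofNat]
    have h1 := h.four_lt
    have h2 := h.lt_max
    exact abs_mul_bounds (abs_mul_bounds (abs_mul_bounds h.apply_t_bounds
      (abs_bounds_of_pos (by linarith) (by linarith)))
      (abs_pow_bounds (abs_bounds_of_pos (by linarith) (by linarith)) 2))
      (abs_bounds_of_pos (by nlinarith) (by nlinarith))
  · simp only [map_mul, map_sub, map_add, map_pow, map_one, map_ofNat]
    have h1 := h.four_mul_le_three_mul (Or.inl rfl) hτ
    rw [eq_three_of_apply_eq h.apply_b, map_ofNat] at h1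
    exact abs_sextic_le (h.nonneg_t τ hτ) (by linarith)

theorem finrank_le_of_four (h : IsEdgeField ι s 4 t a b) (hs : s = 3 ∨ s = 4) :
    finrank ℚ K ≤ 20 := by
  refine finrank_le_of_abs_le ι (z := t * (t - 1) ^ 3) (C := 3 / 16)
    (Z := 196 * 195 ^ 3) ?_ ?_ (fun τ hτ => ?_)
    (by norm_num) (by norm_num) (by norm_num)
  · simp (maxDischargeDepth := 12) only [IsIntegral.mul, IsIntegral.sub, IsIntegral.pow, isIntegral_one, h.isIntegral_t]
  · simp only [map_mul, map_sub, map_pow, map_one]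
    have h1 := h.four_lt
    have h2 := h.lt_max
    exact abs_mul_bounds h.apply_t_bounds
      (abs_pow_bounds (abs_bounds_of_pos (by linarith) (by linarith)) 3)
  · simp only [map_mul, map_sub, map_pow, map_one]
    have h1 := h.four_mul_le_three_mul hs hτ
    rw [eq_two_of_apply_eq h.apply_b, map_ofNat] at h1
    exact abs_mul_sub_one_cube_le (h.nonneg_t τ hτ) (by linarith)

theorem finrank_le_of_three_five (h : IsEdgeField ι s 5 t a b) (hs : s = 3 ∨ s = 4) :
    finrank ℚ K ≤ 20 := by
  -- The degree is even because `ℚ(√5)` lies in `K`.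
  suffices finrank ℚ K ≤ 21 by have := h.two_dvd_finrank; lia
  refine finrank_le_of_abs_le ι (z := t * (t - 1) * (t - (b - 1)) * (3 - b) ^ 3) (C := 0.4)
    (Z := 196 * 195 * 196 * 1.6181 ^ 3) ?_ ?_ (fun τ hτ => ?_)
    (by norm_num) (by norm_num) (by norm_num)
  · simp (maxDischargeDepth := 12) only [IsIntegral.mul, IsIntegral.sub, IsIntegral.pow, isIntegral_one,
      isIntegral_int_ofNat, h.isIntegral_t, h.isIntegral_b]
  · simp only [map_mul, map_sub, map_pow, map_one, map_ofNat]
    have h1 := h.four_lt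
    have h2 := h.lt_max
    obtain ⟨-, h3, h4⟩ := quadratic_of_apply_eq h.apply_b
    exact abs_mul_bounds (abs_mul_bounds (abs_mul_bounds h.apply_t_bounds
      (abs_bounds_of_pos (by linarith) (by linarith)))
      (abs_bounds_of_pos (by linarith) (by linarith)))
      (abs_pow_bounds (abs_bounds_of_pos (by linarith) (by linarith)) 3)
  · simp only [map_mul, map_sub, map_pow, map_one, map_ofNat]
    exact abs_cubic_mul_le (h.quadratic_b τ) (h.nonneg_t τ hτ) (h.four_mul_le_three_mul hs hτ)

theorem finrank_le_of_three_eight_le (h : IsEdgeField ι s k t a b) (hs : s = 3 ∨ s = 4)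
    (hk : 8 ≤ k ∨ k = 6) : finrank ℚ K ≤ 20 := by
  refine finrank_le_of_abs_le_mul ι
    (z := t ^ 3 * (2 * t - b) ^ 2 * (5 * t ^ 2 - 5 * t * b + b ^ 2) ^ 2) (w := b ^ 9) (A := 0.45)
    (B := 1.75) (C := 1 / 2000) (D := 9) (Z := 196 ^ 3 * 392 ^ 2 * (5 * 196 ^ 2) ^ 2)
    ?_ ?_ (fun τ hτ => ?_) ?_ (h.norm_b_le hk) (by norm_num) (by norm_num) (by norm_num)
    (by norm_num) (by norm_num)
  · simp (maxDischargeDepth := 12) only [IsIntegral.mul, IsIntegral.add, IsIntegral.sub, IsIntegral.pow,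
      isIntegral_int_ofNat, h.isIntegral_t, h.isIntegral_b]
  · simp only [map_mul, map_sub, map_add, map_pow, map_ofNat]
    have h1 := h.four_lt
    have h2 := h.lt_max
    have h3 := h.apply_b_pos
    have h4 := h.apply_b_le
    exact abs_mul_bounds (abs_mul_bounds (abs_pow_bounds h.apply_t_bounds 3)
      (abs_pow_bounds (abs_bounds_of_pos (by linarith) (by linarith)) 2))
      (abs_pow_bounds (abs_bounds_of_pos (by nlinarith) (by nlinarith)) 2)
  · simp only [map_mul, map_sub, map_add, map_pow, map_ofNat]
    have hb := h.b_pos hτ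
    have h1 := h.four_mul_le_three_mul hs hτ
    obtain ⟨v, hv, hv0, -⟩ := h.exists_eq_mul hτ
    rw [hv] at h1 ⊢
    have h2 : v ≤ 3 / 4 := by
      by_contra! h'
      nlinarith
    have h3 := nonic_le hv0 h2
    rw [abs_of_pos (pow_pos hb 9)]
    calc _ = |v ^ 3 * (2 * v - 1) ^ 2 * (5 * v ^ 2 - 5 * v + 1) ^ 2 * τ b ^ 9| := by
          congr 1; ring
      _ = v ^ 3 * (2 * v - 1) ^ 2 * (5 * v ^ 2 - 5 * v + 1) ^ 2 * τ b ^ 9 :=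
          abs_of_nonneg (by positivity)
      _ ≤ _ := by gcongr
  · rw [map_pow]
    exact pow_pos h.apply_b_pos 9

theorem finrank_le_of_three_seven (h : IsEdgeField ι 3 7 t a b) : finrank ℚ K ≤ 21 := by
  -- The degree is a multiple of 3, so 23 may be lowered to 21.
  suffices finrank ℚ K ≤ 23 by have := h.three_dvd_finrank; lia
  refine finrank_le_of_abs_le ι (z := t ^ 2 * (t - 1) ^ 2 * (t - (b - 1)) ^ 2 *
    (t - (3 - 4 * b + b ^ 2)) * (t - (-2 + 4 * b - b ^ 2)) * (t - (2 - 3 * b + b ^ 2)) *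
    ((b - 2) ^ 3 * (4 - b) ^ 5)) (C := 0.094)
    (Z := 196 ^ 2 * 195 ^ 2 * 196.25 ^ 2 * 196 * 196 * 196 * (1.2471 ^ 3 * 3.2471 ^ 5))
    ?_ ?_ (fun τ hτ => ?_) (by norm_num) (by norm_num) (by norm_num)
  · simp (maxDischargeDepth := 12) only [IsIntegral.mul, IsIntegral.add, IsIntegral.sub, IsIntegral.pow, IsIntegral.neg,
      isIntegral_one, isIntegral_int_ofNat, h.isIntegral_t, h.isIntegral_b]
  · simp only [map_mul, map_sub, map_add, map_neg, map_pow, map_one, map_ofNat]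
    have h1 := h.four_lt
    have h2 := h.lt_max
    obtain ⟨-, h3, h4⟩ := cubic_of_apply_eq h.apply_b
    exact abs_mul_bounds (abs_mul_bounds (abs_mul_bounds (abs_mul_bounds (abs_mul_bounds
      (abs_mul_bounds (abs_pow_bounds h.apply_t_bounds 2)
      (abs_pow_bounds (abs_bounds_of_pos (by linarith) (by linarith)) 2))
      (abs_pow_bounds (abs_bounds_of_pos (by linarith) (by linarith)) 2))
      (abs_bounds_of_pos (by nlinarith) (by nlinarith)))
      (abs_bounds_of_pos (by nlinarith) (by nlinarith)))
      (abs_bounds_of_pos (by nlinarith) (by nlinarith)))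
      (abs_mul_bounds (abs_pow_bounds (abs_bounds_of_neg (by linarith) (by linarith)) 3)
      (abs_pow_bounds (abs_bounds_of_pos (by linarith) (by linarith)) 5))
  · simp only [map_mul, map_sub, map_add, map_neg, map_pow, map_one, map_ofNat]
    exact abs_septic_nonic_mul_le (h.nonneg_b τ hτ) (h.b_le τ hτ) (h.cubic_b τ) (h.nonneg_t τ hτ)
      (h.four_mul_le_three_mul (Or.inl rfl) hτ)

theorem finrank_le_of_four_seven (h : IsEdgeField ι 4 7 t a b) : finrank ℚ K ≤ 20 := by
  refine finrank_le_of_abs_le ι (z := (t * (t - 1)) ^ 3 * ((4 - b) ^ 3 * (b - 1))) (C := 0.12)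
    (Z := (196 * 195) ^ 3 * (3.2471 ^ 3 * 0.2471)) ?_ ?_ (fun τ hτ => ?_)
    (by norm_num) (by norm_num) (by norm_num)
  · simp (maxDischargeDepth := 12) only [IsIntegral.mul, IsIntegral.sub, IsIntegral.pow, isIntegral_one,
      isIntegral_int_ofNat, h.isIntegral_t, h.isIntegral_b]
  · simp only [map_mul, map_sub, map_pow, map_one, map_ofNat]
    have h1 := h.four_lt
    have h2 := h.lt_max
    obtain ⟨-, h3, h4⟩ := cubic_of_apply_eq h.apply_b
    exact abs_mul_bounds (abs_pow_bounds (abs_mul_bounds h.apply_t_bounds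
      (abs_bounds_of_pos (by linarith) (by linarith))) 3)
      (abs_mul_bounds (abs_pow_bounds (abs_bounds_of_pos (by linarith) (by linarith)) 3)
      (abs_bounds_of_neg (by linarith) (by linarith)))
  · simp only [map_mul, map_sub, map_pow, map_one, map_ofNat]
    have h1 := h.t_le τ hτ
    rw [eq_two_of_apply_eq h.apply_a, map_ofNat] at h1
    exact abs_sextic_mul_le (h.nonneg_b τ hτ) (h.b_le τ hτ) (h.cubic_b τ) (h.nonneg_t τ hτ) h1

theorem finrank_le_of_five_five (h : IsEdgeField ι 5 5 t a b) : finrank ℚ K ≤ 20 := by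
  have hab : a = b := ι.injective (h.apply_a.trans h.apply_b.symm)
  suffices finrank ℚ K ≤ 21 by have := h.two_dvd_finrank; lia
  refine finrank_le_of_abs_le ι (z := t * (t - (b - 1)) * (3 - b) ^ 4) (C := 0.4)
    (Z := 196 * 196 * 1.6181 ^ 4) ?_ ?_ (fun τ hτ => ?_)
    (by norm_num) (by norm_num) (by norm_num)
  · simp (maxDischargeDepth := 12) only [IsIntegral.mul, IsIntegral.sub, IsIntegral.pow, isIntegral_one,
      isIntegral_int_ofNat, h.isIntegral_t, h.isIntegral_b]
  · simp only [map_mul, map_sub, map_pow, map_one, map_ofNat]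
    have h1 := h.four_lt
    have h2 := h.lt_max
    obtain ⟨-, h3, h4⟩ := quadratic_of_apply_eq h.apply_b
    exact abs_mul_bounds (abs_mul_bounds h.apply_t_bounds
      (abs_bounds_of_pos (by linarith) (by linarith)))
      (abs_pow_bounds (abs_bounds_of_pos (by linarith) (by linarith)) 4)
  · simp only [map_mul, map_sub, map_pow, map_one, map_ofNat]
    have h1 := h.t_le τ hτ
    rw [hab] at h1
    exact abs_quadratic_mul_le (h.quadratic_b τ) (h.nonneg_t τ hτ) h1

theorem finrank_le_of_seven_seven (h : IsEdgeField ι 7 7 t a b) : finrank ℚ K ≤ 21 := by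
  have hab : a = b := ι.injective (h.apply_a.trans h.apply_b.symm)
  suffices finrank ℚ K ≤ 23 by have := h.three_dvd_finrank; lia
  refine finrank_le_of_abs_le ι (z := (t * (t - (b - 1)) * (b - 2)) ^ 2 * (4 - b) ^ 3) (C := 0.3)
    (Z := (196 * 196.25 * 1.2471) ^ 2 * 3.2471 ^ 3) ?_ ?_ (fun τ hτ => ?_)
    (by norm_num) (by norm_num) (by norm_num)
  · simp (maxDischargeDepth := 12) only [IsIntegral.mul, IsIntegral.sub, IsIntegral.pow, isIntegral_one,
      isIntegral_int_ofNat, h.isIntegral_t, h.isIntegral_b]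
  · simp only [map_mul, map_sub, map_pow, map_one, map_ofNat]
    have h1 := h.four_lt
    have h2 := h.lt_max
    obtain ⟨-, h3, h4⟩ := cubic_of_apply_eq h.apply_b
    exact abs_mul_bounds (abs_pow_bounds (abs_mul_bounds (abs_mul_bounds h.apply_t_bounds
      (abs_bounds_of_pos (by linarith) (by linarith)))
      (abs_bounds_of_neg (by linarith) (by linarith))) 2)
      (abs_pow_bounds (abs_bounds_of_pos (by linarith) (by linarith)) 3)
  · simp only [map_mul, map_sub, map_pow, map_one, map_ofNat]
    have h1 := h.t_le τ hτ
    rw [hab] at h1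
    exact abs_septic_unit_mul_le (h.nonneg_b τ hτ) (h.b_le τ hτ) (h.cubic_b τ) (h.nonneg_t τ hτ) h1

/-- The norm bound for `b` is left as a hypothesis, so that the same form serves `k = 7`, where
`|N(b)|` grows faster than `1.75^N`. -/
theorem finrank_le_of_five (h : IsEdgeField ι 5 k t a b) {A B : ℝ} {n : ℕ}
    (hnorm : n < finrank ℚ K → |((Algebra.norm ℚ b : ℚ) : ℝ)| ≤ A * B ^ finrank ℚ K * ι b)
    (hA : 0 ≤ A) (hB : 0 ≤ B) (hCB : 0.142 * B ^ 2 ≤ 1)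
    (hlt : 196 * (3.6181 * 196) * 1.6181 * 0.142 ^ n * (A * B ^ (n + 1)) ^ 2 < 1) :
    finrank ℚ K ≤ n := by
  refine finrank_le_of_abs_le_mul ι (z := t * ((5 - a) * t - b) * (3 - a)) (w := b ^ 2)
    ?_ ?_ (fun τ hτ => ?_) ?_ (fun hN => ?_) hA hB (by norm_num) hCB hlt
  · simp (maxDischargeDepth := 12) only [IsIntegral.mul, IsIntegral.sub,
      isIntegral_int_ofNat, h.isIntegral_t, h.isIntegral_a, h.isIntegral_b]
  · simp only [map_mul, map_sub, map_ofNat]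
    have h1 := h.four_lt
    have h2 := h.lt_max
    have h3 := h.apply_b_pos
    have h4 := h.apply_b_le
    obtain ⟨-, h5, h6⟩ := quadratic_of_apply_eq h.apply_a
    exact abs_mul_bounds (abs_mul_bounds h.apply_t_bounds
      (abs_bounds_of_pos (by nlinarith) (by nlinarith)))
      (abs_bounds_of_pos (by linarith) (by linarith))
  · simp only [map_mul, map_sub, map_pow, map_ofNat]
    obtain ⟨v, hv, hv0, hv1⟩ := h.exists_eq_mul hτ
    have h1 := abs_homogeneous_quadratic_le (h.symm.quadratic_b τ) hv0 hv1
    rw [hv]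
    calc _ = |v * ((5 - τ a) * v - 1) * (3 - τ a)| * |τ b ^ 2| := by
          rw [← abs_mul]; congr 1; ring
      _ ≤ _ := by gcongr
  · rw [map_pow]
    exact pow_pos h.apply_b_pos 2
  · rw [map_pow, map_pow, Rat.cast_pow, abs_pow, ← mul_pow]
    exact pow_le_pow_left₀ (abs_nonneg _) (hnorm hN) 2

theorem finrank_le_of_five_eight_le (h : IsEdgeField ι 5 k t a b) (hk : 8 ≤ k ∨ k = 6) :
    finrank ℚ K ≤ 20 :=
  h.finrank_le_of_five (fun hN => abs_norm_le_mul_apply hk h.apply_b hN) (by norm_num)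
    (by norm_num) (by norm_num) (by norm_num)

theorem finrank_le_of_five_seven (h : IsEdgeField ι 5 7 t a b) : finrank ℚ K ≤ 20 := by
  -- Both 2 and 3 divide the degree, so it is a multiple of 6.
  suffices finrank ℚ K ≤ 23 by
    have := h.three_dvd_finrank
    have := h.symm.two_dvd_finrank
    lia
  -- 1.913 exceeds `7^(1/3)`, the growth rate of `|N(b)|`, and 1.3281 exceeds `1/0.753 ≥ 1/ι b`.
  refine h.finrank_le_of_five (A := 1.3281) (B := 1.913) (fun hN => ?_) (by norm_num)
    (by norm_num) (by norm_num) (by norm_num)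
  have h1 : |((Algebra.norm ℚ b : ℚ) : ℝ)| ≤ 1.913 ^ finrank ℚ K := by
    refine abs_norm_le_pow (by norm_num) h.apply_b (by norm_num) ?_
    have : Fact (Nat.Prime 7) := ⟨by norm_num⟩
    rw [Polynomial.eval_one_cyclotomic_prime, show Nat.totient 7 = 6 by decide]
    norm_num
  obtain ⟨-, h2, -⟩ := cubic_of_apply_eq h.apply_b
  have h3 : (0 : ℝ) < 1.913 ^ finrank ℚ K := by positivity
  nlinarith

theorem finrank_le_of_seven_eight_le (h : IsEdgeField ι 7 k t a b) (hk : 8 ≤ k ∨ k = 6) :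
    finrank ℚ K ≤ 20 := by
  refine finrank_le_of_abs_le_mul ι
    (z := t ^ 2 * (t - b) * ((10 - 6 * a + a ^ 2) * t - b) * ((a - 2) ^ 2 * (4 - a)))
    (w := b ^ 4) (A := 0.45) (B := 1.75) (C := 0.0325) (D := 4)
    (Z := 196 ^ 2 * 196 * (6.05 * 196) * (1.2471 ^ 2 * 3.2471))
    ?_ ?_ (fun τ hτ => ?_) ?_ (h.norm_b_le hk) (by norm_num) (by norm_num) (by norm_num)
    (by norm_num) (by norm_num)
  · simp (maxDischargeDepth := 12) only [IsIntegral.mul, IsIntegral.add, IsIntegral.sub, IsIntegral.pow,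
      isIntegral_int_ofNat, h.isIntegral_t, h.isIntegral_a, h.isIntegral_b]
  · simp only [map_mul, map_sub, map_add, map_pow, map_ofNat]
    have h1 := h.four_lt
    have h2 := h.lt_max
    have h3 := h.apply_b_pos
    have h4 := h.apply_b_le
    obtain ⟨-, h5, h6⟩ := cubic_of_apply_eq h.apply_a
    have h7 : 6 ≤ 10 - 6 * ι a + ι a ^ 2 := by nlinarith
    have h8 : 10 - 6 * ι a + ι a ^ 2 ≤ 6.05 := by nlinarith
    exact abs_mul_bounds (abs_mul_bounds (abs_mul_bounds (abs_pow_bounds h.apply_t_bounds 2)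
      (abs_bounds_of_pos (by linarith) (by linarith)))
      (abs_bounds_of_pos (by nlinarith) (by nlinarith)))
      (abs_mul_bounds (abs_pow_bounds (abs_bounds_of_neg (by linarith) (by linarith)) 2)
      (abs_bounds_of_pos (by linarith) (by linarith)))
  · simp only [map_mul, map_sub, map_add, map_pow, map_ofNat]
    obtain ⟨v, hv, hv0, hv1⟩ := h.exists_eq_mul hτ
    have h1 := abs_homogeneous_quartic_le (h.nonneg_a τ hτ) (h.a_le τ hτ) (h.symm.cubic_b τ)
      hv0 hv1
    rw [hv]
    calc _ = |v ^ 2 * (v - 1) * ((10 - 6 * τ a + τ a ^ 2) * v - 1) *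
          ((τ a - 2) ^ 2 * (4 - τ a))| * |τ b ^ 4| := by
          rw [← abs_mul]; congr 1; ring
      _ ≤ _ := by gcongr
  · rw [map_pow]
    exact pow_pos h.apply_b_pos 4

/-- The degree bound for `s ≤ k`. -/
theorem finrank_le (h : IsEdgeField ι s k t a b) (hsk : s ≤ k) :
    finrank ℚ K ≤ if s = 3 ∧ k = 3 then 25 else
      if s = 3 ∧ k = 7 ∨ s = 7 ∧ k = 7 then 21 else 20 := by
  have h3 := h.three_le_s
  have hs : s = 3 ∨ s = 4 ∨ s = 5 ∨ s = 7 ∨ 8 ≤ s ∨ s = 6 := by lia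
  have hk : k = 3 ∨ k = 4 ∨ k = 5 ∨ k = 7 ∨ 8 ≤ k ∨ k = 6 := by lia
  rcases hs with rfl | rfl | rfl | rfl | hs <;> rcases hk with rfl | rfl | rfl | rfl | hk
  all_goals try lia
  · simpa using h.finrank_le_of_three_three
  · simpa using h.finrank_le_of_four (Or.inl rfl)
  · simpa using h.finrank_le_of_three_five (Or.inl rfl)
  · simpa using h.finrank_le_of_three_seven
  · rw [if_neg (by lia), if_neg (by lia)]
    exact h.finrank_le_of_three_eight_le (Or.inl rfl) hk
  · simpa using h.finrank_le_of_four (Or.inr rfl)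
  · simpa using h.finrank_le_of_three_five (Or.inr rfl)
  · simpa using h.finrank_le_of_four_seven
  · rw [if_neg (by lia), if_neg (by lia)]
    exact h.finrank_le_of_three_eight_le (Or.inr rfl) hk
  · simpa using h.finrank_le_of_five_five
  · simpa using h.finrank_le_of_five_seven
  · rw [if_neg (by lia), if_neg (by lia)]
    exact h.finrank_le_of_five_eight_le hk
  · simpa using h.finrank_le_of_seven_seven
  · rw [if_neg (by lia), if_neg (by lia)]
    exact h.finrank_le_of_seven_eight_le hk
  · rw [if_neg (by lia), if_neg (by lia)]
    -- Since `s ≤ k = 7`, this is the pair 6, 7, with the roles of the two ends exchanged.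
    exact h.symm.finrank_le_of_seven_eight_le hs
  · rw [if_neg (by lia), if_neg (by lia)]
    exact h.finrank_le_of_eight_le hs hk

end IsEdgeField

end EdgeFieldDegree

theorem mainTheorem9 :
    (∀ (s k : ℕ), 3 ≤ s → s ≤ k → ∀ A ∈ gamma5Graphs 14 s k,
      FiniteDimensional ℚ (groundField A) ∧
      (s = 3 ∧ k = 3 → Module.finrank ℚ (groundField A) ≤ 25) ∧
      (s = 3 ∧ k = 7 → Module.finrank ℚ (groundField A) ≤ 21) ∧
      (s = 7 ∧ k = 7 → Module.finrank ℚ (groundField A) ≤ 21) ∧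
      (¬ (s = 3 ∧ k = 3) → ¬ (s = 3 ∧ k = 7) → ¬ (s = 7 ∧ k = 7) →
        Module.finrank ℚ (groundField A) ≤ 20)) ∧
    (∀ K ∈ gamma5Fields 14, FiniteDimensional ℚ K ∧ Module.finrank ℚ K ≤ 25) := by
  have key : ∀ s k : ℕ, 3 ≤ s → s ≤ k → ∀ A ∈ gamma5Graphs 14 s k,
      FiniteDimensional ℚ (groundField A) ∧ Module.finrank ℚ (groundField A) ≤
        if s = 3 ∧ k = 3 then 25 else if s = 3 ∧ k = 7 ∨ s = 7 ∧ k = 7 then 21 else 20 := by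
    intro s k hs hsk A hA
    have := numberField_groundField hA.2.1
    have := isTotallyReal_groundField hA.2.1
    obtain ⟨t, a, b, h⟩ := isEdgeField_groundField hs (hs.trans hsk) hA
    exact ⟨finiteDimensional_groundField hA.2.1, h.finrank_le hsk⟩
  refine ⟨fun s k hs hsk A hA => ?_, ?_⟩
  · obtain ⟨h1, h2⟩ := key s k hs hsk A hA
    refine ⟨h1, fun h => ?_, fun h => ?_, fun h => ?_, fun h h' h'' => ?_⟩ <;>
      split_ifs at h2 <;> lia
  · rintro _ ⟨s, k, hs, hsk, A, hA, rfl⟩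
    obtain ⟨h1, h2⟩ := key s k hs hsk A hA
    refine ⟨h1, ?_⟩
    split_ifs at h2 <;> lia
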